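/- Let $p>2$ and $\omega>0$. For real-valued $u\in L^2(\mathbb R)$ such that $u^2$ is locally absolutely continuous and $u\,\partial_xu:=\tfrac12\partial_x(u^2)\in L^2(\mathbb R)$, put $$N[u]=\int_{\mathbb R}|u\,\partial_x u|^2\,dx+\omega\int_{\mathbb R}|u|^2\,dx .$$ Let $\Phi$ be a bell-shaped function (even, nonnegative, nonincreasing on $(0,\infty)$) that minimizes $N[u]$ among all such $u$ subject to $\int_{\mathbb R}|u|^p\,dx=1$. Let $[-L,L]$ be the support of $\Phi$ (it is compact), and put $$c(\omega)=2\int_{\mathbb R}(\Phi\Phi')^2\,dx+\omega\int_{\mathbb R}\Phi^2\,dx ,$$ the Lagrange multiplier of this problem. Let $\mathcal L_-$ be any self-adjoint extension, in the complex Hilbert space $L^2(-L,L)$, of the symmetric operator $$\mathcal L_-f=-\Phi\,\partial_x^2(\Phi f)+2\bigl(\omega-c(\omega)\Phi^{p-2}\bigr)f,\qquad f\in C_0^\infty(-L,L).$$ Then $\mathcal L_-\ge 0$, that is, $\langle\mathcal L_-u,u\rangle\ge0$ for every $u$ in the domain of $\mathcal L_-$, and zero is a simple eigenvalue of $\mathcal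 L_-$, with $\operatorname{Ker}\mathcal L_-=\operatorname{span}[\Phi]$. -/

import Mathlib

open MeasureTheory

noncomputable section

/-- `f : ℝ → ℝ` is bell-shaped: even, nonnegative, and nonincreasing on `(0, ∞)`. -/
structure IsBellShaped (f : ℝ → ℝ) : Prop where
  even : ∀ x, f (-x) = f x
  nonneg : ∀ x, 0 ≤ f x
  antitoneOn : AntitoneOn f (Set.Ioi 0)

/-- `∫ |u ∂ₓu|²`, where the product `u ∂ₓu` is read as `∂ₓ(u²) / 2`. -/
def kineticEnergy (u : ℝ → ℝ) : ℝ :=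
  ∫ x, (deriv (fun y => u y ^ 2) x / 2) ^ 2

/-- The functional `N[u] = ∫ |u ∂ₓu|² + ω ∫ |u|²`. -/
def energyN (ω : ℝ) (u : ℝ → ℝ) : ℝ :=
  kineticEnergy u + ω * ∫ x, u x ^ 2

/-- The admissible class: `u ∈ L²`, `u²` is (locally absolutely continuous and) weakly
differentiable with `u ∂ₓu ∈ L²`, and `∫ |u|^p = 1`. -/
structure IsAdmissible (p : ℝ) (u : ℝ → ℝ) : Prop where
  memLp : MemLp u 2 volume
  absCont : ∀ a b : ℝ, AbsolutelyContinuousOnInterval (fun x => u x ^ 2) a b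
  memLp_deriv : MemLp (deriv (fun x => u x ^ 2)) 2 volume
  norm_one : ∫ x, |u x| ^ p = 1

/-- `Φ` is a bell-shaped solution of the problem
`N[u] → min` subject to `∫ |u|^p = 1`. -/
structure IsBellShapedMinimizer (p ω : ℝ) (Φ : ℝ → ℝ) : Prop where
  bellShaped : IsBellShaped Φ
  admissible : IsAdmissible p Φ
  minimal : ∀ u : ℝ → ℝ, IsAdmissible p u → energyN ω Φ ≤ energyN ω u

/-- The Lagrange multiplier `c(ω) = 2 ∫ (Φ Φ')² + ω ∫ Φ²`. -/
def lagrangeMultiplier (ω : ℝ) (Φ : ℝ → ℝ) : ℝ :=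
  2 * kineticEnergy Φ + ω * ∫ x, Φ x ^ 2

/-- The number `L` with `supp Φ = [-L, L]`. -/
def halfLength (Φ : ℝ → ℝ) : ℝ := sSup (Function.support Φ)

/-- The open interval `(-L, L)`. -/
def bodyInterval (Φ : ℝ → ℝ) : Set ℝ := Set.Ioo (-halfLength Φ) (halfLength Φ)

/-- The complex Hilbert space `L²(-L, L)`. -/
abbrev BaseSpace (Φ : ℝ → ℝ) : Type :=
  Lp ℂ 2 (volume.restrict (bodyInterval Φ))

/-- The space `C₀^∞(U)` of smooth functions whose support is compact and contained in `U`. -/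
structure IsTestFunction (U : Set ℝ) (f : ℝ → ℂ) : Prop where
  smooth : ContDiff ℝ ((⊤ : ℕ∞) : WithTop ℕ∞) f
  compact : HasCompactSupport f
  support_subset : tsupport f ⊆ U

/-- The differential expression
`𝓛₋ f = -Φ ∂ₓ²(Φ f) + 2 (ω - c(ω) Φ^(p-2)) f`. -/
def LMinusExpr (p ω : ℝ) (Φ : ℝ → ℝ) (f : ℝ → ℂ) (x : ℝ) : ℂ :=
  -(Φ x : ℂ) * deriv (deriv (fun y => (Φ y : ℂ) * f y)) x
    + 2 * ((ω - lagrangeMultiplier ω Φ * Φ x ^ (p - 2) : ℝ) : ℂ) * f x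

/-- The graph in `L²(-L, L) × L²(-L, L)` of the symmetric operator `f ↦ 𝓛₋ f` with domain
`C₀^∞(-L, L)`. -/
def LMinusGraph (p ω : ℝ) (Φ : ℝ → ℝ) : Set (BaseSpace Φ × BaseSpace Φ) :=
  {w | ∃ f : ℝ → ℂ, IsTestFunction (bodyInterval Φ) f ∧
    w.1 =ᵐ[volume.restrict (bodyInterval Φ)] f ∧
    w.2 =ᵐ[volume.restrict (bodyInterval Φ)] LMinusExpr p ω Φ f}

/-- `A` is a self-adjoint extension of the symmetric operator `f ↦ 𝓛₋ f` on `C₀^∞(-L, L)`.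
(A self-adjoint `A` is densely defined.) -/
structure IsSelfAdjointExtension (p ω : ℝ) (Φ : ℝ → ℝ)
    (A : BaseSpace Φ →ₗ.[ℂ] BaseSpace Φ) : Prop where
  extends_graph : LMinusGraph p ω Φ ⊆ (A.graph : Set (BaseSpace Φ × BaseSpace Φ))
  selfAdjoint : IsSelfAdjoint A

/-- The kernel of an unbounded operator, as a subspace of the Hilbert space. -/
def operatorKernel {H : Type*} [AddCommGroup H] [Module ℂ H] (A : H →ₗ.[ℂ] H) :
    Submodule ℂ H :=
  (LinearMap.ker A.toFun).map A.domain.subtype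

end

/-! ### Test functions and weak solutions of Sturm–Liouville equations. -/

section

open Set Filter Topology
open scoped ContDiff

/-! Put `v = Φ²` and substitute `f = Φ φ`. The Euler–Lagrange equation `½ v'' = ω - c Φ^(p-2)` turns
the potential of `𝓛₋` into `v''`, which cancels the zeroth-order term, and `𝓛₋ (Φ φ) = -Φ⁻¹ (v²
φ')'` (`LMinusExpr_mul`). Formally the quadratic form is then `∫ v² |φ'|²`, nonnegative and zero
only for constant `φ`. What remains is to control the boundary terms for an arbitrary self-adjoint
extension.

If `u` is in the domain of such an extension and `g` is its image, symmetry against test functions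
makes `u = Φ H` a weak solution with flux `P = v² H'` and `P' = -Φ g` (`exists_flux`, applied to
real and imaginary parts). Since `Φ g` is integrable, `P` is continuous up to `±L`. The weight `v`
is comparable to `(L - |x|)²` at the edges. A nonzero limit of `P` would force `|H|` to grow like
`(L - |x|)⁻³`, so that `v H² = |u|²` is not integrable; hence `P (±L) = 0` (`flux_limit_eq_zero`).
In the same way `P H` cannot stay above a positive constant near the right edge, nor `-P H` near the
left one. This gives `∫ g u ≥ 0` (`integral_mul_nonneg`). If `g = 0` then `P = 0`, so `H` is
constant (`eq_const_mul_sqrt`). Conversely `∫ g Φ = P (-L) - P L = 0` (`integral_mul_sqrt_eq_zero`),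
so `Φ` is orthogonal to the range and lies in the kernel of the adjoint, which is the operator
itself.

The edge behaviour comes from minimality. Where `Φ` is small, `v'' ≥ ω`; with monotonicity this
gives the lower quadratic bound and compact support (`quadratic_le_sq`, `bddAbove_support`). Adding
a small nonnegative tent centred at the edge gives the upper bound (`sq_le_quadratic`). -/

/-- Real-valued smooth functions with compact support inside `(a, b)`. -/
structure IsRealTest (a b : ℝ) (ψ : ℝ → ℝ) : Prop where
  smooth : ContDiff ℝ ∞ ψ
  compact : HasCompactSupport ψ
  subset : tsupport ψ ⊆ Ioo a b

/-- Off `tsupport ψ` the product is locally zero, so the behaviour of `f` outside `U` is irrelevant.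
This permits multiplication by powers of `Φ`, whose smoothness is known only inside its support
interval. -/
theorem contDiff_mul_of_tsupport_subset {U : Set ℝ} (hU : IsOpen U) {f ψ : ℝ → ℝ}
    (hf : ContDiffOn ℝ ∞ f U) (hψ : ContDiff ℝ ∞ ψ) (h : tsupport ψ ⊆ U) :
    ContDiff ℝ ∞ (fun x => f x * ψ x) := by
  rw [contDiff_iff_contDiffAt]
  intro x
  by_cases hx : x ∈ tsupport ψ
  · exact (hf.contDiffAt (hU.mem_nhds (h hx))).mul hψ.contDiffAt
  · have : (fun x => f x * ψ x) =ᶠ[𝓝 x] fun _ => 0 := by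
      filter_upwards [notMem_tsupport_iff_eventuallyEq.1 hx] with y hy
      simp [hy]
    exact contDiffAt_const.congr_of_eventuallyEq this

namespace IsRealTest

variable {a b : ℝ} {ψ χ f F : ℝ → ℝ}

theorem eq_zero (hψ : IsRealTest a b ψ) {x : ℝ} (hx : x ∉ Ioo a b) : ψ x = 0 :=
  image_eq_zero_of_notMem_tsupport fun h => hx (hψ.subset h)

theorem deriv (hψ : IsRealTest a b ψ) : IsRealTest a b (deriv ψ) where
  smooth := by
    have := hψ.smooth
    rw [show (∞ : WithTop ℕ∞) = ∞ + 1 from rfl, contDiff_succ_iff_deriv] at this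
    exact this.2.2
  compact := hψ.compact.deriv
  subset := (tsupport_deriv_subset).trans hψ.subset

theorem mul_left (hψ : IsRealTest a b ψ) (hf : ContDiffOn ℝ ∞ f (Ioo a b)) :
    IsRealTest a b (fun x => f x * ψ x) where
  smooth := contDiff_mul_of_tsupport_subset isOpen_Ioo hf hψ.smooth hψ.subset
  compact := hψ.compact.mul_left
  subset := (tsupport_mul_subset_right).trans hψ.subset

theorem sub (hψ : IsRealTest a b ψ) (hχ : IsRealTest a b χ) :
    IsRealTest a b (fun x => ψ x - χ x) where
  smooth := hψ.smooth.sub hχ.smooth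
  compact := hψ.compact.sub hχ.compact
  subset := (tsupport_sub ψ χ).trans (union_subset hψ.subset hχ.subset)

theorem const_mul (hψ : IsRealTest a b ψ) (k : ℝ) : IsRealTest a b (fun x => k * ψ x) :=
  hψ.mul_left contDiffOn_const

theorem continuous (hψ : IsRealTest a b ψ) : Continuous ψ := hψ.smooth.continuous

theorem hasDerivAt (hψ : IsRealTest a b ψ) (x : ℝ) : HasDerivAt ψ (_root_.deriv ψ x) x :=
  (hψ.smooth.differentiable (by simp) x).hasDerivAt

theorem integrable (hψ : IsRealTest a b ψ) : Integrable ψ :=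
  hψ.continuous.integrable_of_hasCompactSupport hψ.compact

theorem integrable_mul (hψ : IsRealTest a b ψ) (hF : LocallyIntegrableOn F (Ioo a b)) :
    Integrable (fun x => F x * ψ x) := by
  have h1 : IntegrableOn F (tsupport ψ) :=
    hF.integrableOn_compact_subset hψ.subset hψ.compact
  have h2 : IntegrableOn (fun x => F x * ψ x) (tsupport ψ) :=
    h1.mul_continuousOn hψ.continuous.continuousOn hψ.compact
  refine (integrableOn_iff_integrable_of_support_subset ?_).1 h2
  intro x hx
  exact subset_tsupport _ (right_ne_zero_of_mul hx)

theorem exists_Icc (hψ : IsRealTest a b ψ) (hab : a < b) :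
    ∃ a' b', a < a' ∧ a' < b' ∧ b' < b ∧ ∀ x, x ∉ Ioo a' b' → ψ x = 0 := by
  obtain hK | hK := (tsupport ψ).eq_empty_or_nonempty
  · obtain ⟨c, hc⟩ := exists_between hab
    obtain ⟨d, hd⟩ := exists_between hc.2
    refine ⟨c, d, hc.1, hd.1, hd.2, fun x _ => ?_⟩
    exact image_eq_zero_of_notMem_tsupport (by simp [hK])
  · have hK' : IsCompact (tsupport ψ) := hψ.compact
    obtain ⟨m, hm, hm'⟩ := hK'.exists_isLeast hK
    obtain ⟨M, hM, hM'⟩ := hK'.exists_isGreatest hK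
    have h1 := hψ.subset hm
    have h2 := hψ.subset hM
    obtain ⟨c, hc⟩ := exists_between h1.1
    obtain ⟨d, hd⟩ := exists_between h2.2
    have h3 : m ≤ M := hm' hM
    refine ⟨c, d, hc.1, by linarith [hc.2, hd.1], hd.2, fun x hx => ?_⟩
    refine image_eq_zero_of_notMem_tsupport fun hx' => hx ⟨?_, ?_⟩
    · linarith [hm' hx', hc.2]
    · linarith [hM' hx', hd.1]

theorem of_support {a' b' : ℝ} (hs : ContDiff ℝ ∞ ψ) (ha : a < a') (hb : b' < b)
    (h : ∀ x, x ∉ Icc a' b' → ψ x = 0) : IsRealTest a b ψ := by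
  have hsub : tsupport ψ ⊆ Icc a' b' := by
    refine closure_minimal (fun x hx => ?_) isClosed_Icc
    by_contra hx'
    exact hx (h x hx')
  exact ⟨hs, isCompact_Icc.of_isClosed_subset (isClosed_tsupport _) hsub,
    hsub.trans (Icc_subset_Ioo ha hb)⟩

/-- Integration by parts against a test function. -/
theorem integral_mul_deriv (hψ : IsRealTest a b ψ)
    (hF : ∀ x ∈ Ioo a b, HasDerivAt F (f x) x) (hf : ContinuousOn f (Ioo a b)) :
    ∫ x, F x * _root_.deriv ψ x = -∫ x, f x * ψ x := by
  have hFc : ContinuousOn F (Ioo a b) := fun x hx => (hF x hx).continuousAt.continuousWithinAt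
  have i1 := hψ.integrable_mul (hf.locallyIntegrableOn measurableSet_Ioo)
  have i2 := hψ.deriv.integrable_mul (hFc.locallyIntegrableOn measurableSet_Ioo)
  have i3 := hψ.integrable_mul (hFc.locallyIntegrableOn measurableSet_Ioo)
  have hd : ∀ x, HasDerivAt (fun x => F x * ψ x) (f x * ψ x + F x * _root_.deriv ψ x) x := by
    intro x
    by_cases hx : x ∈ tsupport ψ
    · exact (hF x (hψ.subset hx)).mul (hψ.hasDerivAt x)
    · have h0 := notMem_tsupport_iff_eventuallyEq.1 hx
      have h1 : (fun x => F x * ψ x) =ᶠ[𝓝 x] fun _ => 0 := by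
        filter_upwards [h0] with y hy
        simp [hy]
      have h2 : f x * ψ x + F x * _root_.deriv ψ x = 0 := by
        rw [h0.deriv_eq, h0.eq_of_nhds]; simp
      rw [h2]
      exact (hasDerivAt_const x (0 : ℝ)).congr_of_eventuallyEq h1
  have := integral_eq_zero_of_hasDerivAt_of_integrable hd (i1.add i2) i3
  rw [integral_add i1 i2] at this
  linarith

/-- Integration by parts for the primitive of an integrable function. -/
theorem integral_primitive_mul_deriv (hψ : IsRealTest a b ψ) (hab : a < b) (hf : Integrable f)
    (c : ℝ) : ∫ x, (∫ t in c..x, f t) * _root_.deriv ψ x = -∫ x, f x * ψ x := by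
  obtain ⟨a', b', h1, h2, h3, h0⟩ := hψ.exists_Icc hab
  have hd0 : ∀ x, x ∉ Icc a' b' → _root_.deriv ψ x = 0 := by
    intro x hx
    have : ψ =ᶠ[𝓝 x] fun _ => 0 := by
      filter_upwards [isClosed_Icc.isOpen_compl.mem_nhds hx] with y hy
      exact h0 y fun h => hy (Ioo_subset_Icc_self h)
    rw [this.deriv_eq]; simp
  have e1 : ∫ x, (∫ t in c..x, f t) * _root_.deriv ψ x
      = ∫ x in a'..b', (∫ t in c..x, f t) * _root_.deriv ψ x := by
    rw [intervalIntegral.integral_of_le h2.le, ← integral_Icc_eq_integral_Ioc]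
    symm
    refine setIntegral_eq_integral_of_forall_compl_eq_zero fun x hx => ?_
    rw [hd0 x hx, mul_zero]
  have e2 : ∫ x, f x * ψ x = ∫ x in a'..b', f x * ψ x := by
    rw [intervalIntegral.integral_of_le h2.le, ← integral_Icc_eq_integral_Ioc]
    symm
    refine setIntegral_eq_integral_of_forall_compl_eq_zero fun x hx => ?_
    rw [h0 x fun h => hx (Ioo_subset_Icc_self h), mul_zero]
  have hac : AbsolutelyContinuousOnInterval (fun x => ∫ t in c..x, f t) a' b' := by
    have := (hf.intervalIntegrable (a := min c a') (b := max c b')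
      ).absolutelyContinuousOnInterval_intervalIntegral (c := c) (by
        rw [uIcc_of_le (by simp)]; simp)
    refine this.mono ?_
    rw [uIcc_of_le h2.le, uIcc_of_le (by simp)]
    exact Icc_subset_Icc (by simp) (by simp)
  have hac' : AbsolutelyContinuousOnInterval ψ a' b' :=
    (hψ.smooth.of_le (by simp)).contDiffOn.absolutelyContinuousOnInterval
  rw [e1, e2, hac.integral_mul_deriv_eq_deriv_mul hac', h0 a' (by simp), h0 b' (by simp)]
  simp only [mul_zero, sub_zero, zero_sub, neg_inj]
  refine intervalIntegral.integral_congr_ae ?_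
  filter_upwards [_root_.LocallyIntegrable.ae_hasDerivAt_integral hf.locallyIntegrable] with x hx _
  rw [(hx c).deriv]

theorem exists_integral_eq_one (hab : a < b) : ∃ χ, IsRealTest a b χ ∧ ∫ x, χ x = 1 := by
  let φ : ContDiffBump ((a + b) / 2) := ⟨(b - a) / 8, (b - a) / 4, by linarith, by linarith⟩
  refine ⟨φ.normed volume, ⟨φ.contDiff_normed, φ.hasCompactSupport_normed, ?_⟩,
    φ.integral_normed⟩
  rw [φ.tsupport_normed_eq, Real.closedBall_eq_Icc]
  exact Icc_subset_Ioo (by simp only [φ]; linarith) (by simp only [φ]; linarith)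

/-- A test function of mean zero is the derivative of a test function. -/
theorem exists_deriv_eq (hab : a < b) (hχ : IsRealTest a b χ) (h0 : ∫ x, χ x = 0) :
    ∃ ψ, IsRealTest a b ψ ∧ _root_.deriv ψ = χ := by
  obtain ⟨a', b', h1, h2, h3, hz⟩ := hχ.exists_Icc hab
  have hd : ∀ x, HasDerivAt (fun x => ∫ t in a'..x, χ t) (χ x) x := fun x =>
    intervalIntegral.integral_hasDerivAt_right (hχ.continuous.intervalIntegrable _ _)
      (hχ.continuous.stronglyMeasurableAtFilter _ _) hχ.continuous.continuousAt
  have hderiv : _root_.deriv (fun x => ∫ t in a'..x, χ t) = χ := funext fun x => (hd x).deriv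
  refine ⟨fun x => ∫ t in a'..x, χ t, of_support ?_ h1 h3 ?_, hderiv⟩
  · rw [show (∞ : WithTop ℕ∞) = ∞ + 1 from rfl, contDiff_succ_iff_deriv, hderiv]
    exact ⟨fun x => (hd x).differentiableAt, by simp, hχ.smooth⟩
  · intro x hx
    rcases not_and_or.1 hx with hx | hx
    · push Not at hx
      refine intervalIntegral.integral_zero_ae (ae_of_all _ fun t ht => hz t fun h => ?_)
      rw [uIoc_of_ge hx.le] at ht
      exact absurd h.1 (not_lt.2 ht.2)
    · push Not at hx
      rw [← h0]
      refine intervalIntegral.integral_eq_integral_of_support_subset fun t ht => ?_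
      have : t ∈ Ioo a' b' := by
        by_contra hc
        exact ht (hz t hc)
      exact ⟨this.1, this.2.le.trans hx.le⟩

end IsRealTest

/-- The lemma of du Bois-Reymond. -/
theorem ae_eq_const_of_integral_mul_deriv_eq_zero {a b : ℝ} (hab : a < b) {F : ℝ → ℝ}
    (hF : LocallyIntegrableOn F (Ioo a b))
    (h : ∀ ψ, IsRealTest a b ψ → ∫ x, F x * deriv ψ x = 0) :
    ∃ C, ∀ᵐ x, x ∈ Ioo a b → F x = C := by
  obtain ⟨χ₀, hχ₀, h1⟩ := IsRealTest.exists_integral_eq_one hab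
  refine ⟨∫ x, F x * χ₀ x, ?_⟩
  have hloc : LocallyIntegrableOn (fun x => F x - ∫ x, F x * χ₀ x) (Ioo a b) :=
    hF.sub (locallyIntegrableOn_const _)
  have := isOpen_Ioo.ae_eq_zero_of_integral_contDiff_smul_eq_zero hloc fun g hg hgc hgs => by
    have hχ : IsRealTest a b g := ⟨hg, hgc, hgs⟩
    have i1 := hχ.integrable_mul hF
    have i2 := hχ₀.integrable_mul hF
    -- Subtracting `(∫ g) χ₀` gives mean zero, which makes the difference the derivative of a test
    -- function.
    have hdiff := hχ.sub (hχ₀.const_mul (∫ x, g x))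
    obtain ⟨ψ, hψ, hψ'⟩ := IsRealTest.exists_deriv_eq hab hdiff (by
      rw [integral_sub hχ.integrable (hχ₀.const_mul _).integrable, integral_const_mul, h1]
      ring)
    have key := h ψ hψ
    have e : ∀ x, F x * deriv ψ x = F x * g x - (∫ x, g x) * (F x * χ₀ x) := by
      intro x; rw [hψ']; ring
    simp_rw [e] at key
    rw [integral_sub i1 (i2.const_mul _), integral_const_mul] at key
    have e2 : ∀ x, g x • (F x - ∫ x, F x * χ₀ x)
        = F x * g x - (∫ x, F x * χ₀ x) * g x := by
      intro x; simp only [smul_eq_mul]; ring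
    simp_rw [e2]
    rw [integral_sub i1 (hχ.integrable.const_mul _), integral_const_mul]
    linarith
  filter_upwards [this] with x hx hxI
  linarith [hx hxI]

theorem exists_hasDerivAt_of_continuousOn_Ioo {a b : ℝ} (hab : a < b) {f : ℝ → ℝ}
    (hf : ContinuousOn f (Ioo a b)) : ∃ F : ℝ → ℝ, ∀ x ∈ Ioo a b, HasDerivAt F (f x) x := by
  obtain ⟨c, hc⟩ := exists_between hab
  refine ⟨fun x => ∫ t in c..x, f t, fun x hx => ?_⟩
  have hsub : uIcc c x ⊆ Ioo a b := by
    intro t ht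
    rcases le_total c x with h | h
    · rw [uIcc_of_le h] at ht
      exact ⟨hc.1.trans_le ht.1, ht.2.trans_lt hx.2⟩
    · rw [uIcc_of_ge h] at ht
      exact ⟨hx.1.trans_le ht.1, ht.2.trans_lt hc.2⟩
  exact intervalIntegral.integral_hasDerivAt_right (hf.mono hsub).intervalIntegrable
    (hf.stronglyMeasurableAtFilter isOpen_Ioo x hx) (hf.continuousAt (isOpen_Ioo.mem_nhds hx))

/-- Weak solutions `h` of `(v² h')' = G'` satisfy `v² h' = G + k`. -/
theorem exists_hasDerivAt_of_weak_sturmLiouville {a b : ℝ} (hab : a < b) {v h G : ℝ → ℝ}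
    (hv : ContDiffOn ℝ ∞ v (Ioo a b)) (hpos : ∀ x ∈ Ioo a b, 0 < v x)
    (hh : LocallyIntegrableOn h (Ioo a b)) (hG : ContinuousOn G (Ioo a b))
    (weak : ∀ φ, IsRealTest a b φ →
      ∫ x, h x * deriv (fun y => v y ^ 2 * deriv φ y) x = -∫ x, G x * deriv φ x) :
    ∃ (k : ℝ) (H : ℝ → ℝ), (∀ x ∈ Ioo a b, HasDerivAt H ((G x + k) / v x ^ 2) x) ∧
      ∀ᵐ x, x ∈ Ioo a b → h x = H x := by
  have hv2 : ContDiffOn ℝ ∞ (fun x => v x ^ 2) (Ioo a b) := hv.pow 2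
  have hne : ∀ x ∈ Ioo a b, v x ^ 2 ≠ 0 := fun x hx => (pow_pos (hpos x hx) 2).ne'
  have hinv : ContDiffOn ℝ ∞ (fun x => (v x ^ 2)⁻¹) (Ioo a b) := hv2.inv hne
  obtain ⟨χ₀, hχ₀, h1⟩ := IsRealTest.exists_integral_eq_one hab
  have hψ₀ := hχ₀.mul_left hv2
  have hGv : ContinuousOn (fun x => G x * (v x ^ 2)⁻¹) (Ioo a b) := hG.mul hinv.continuousOn
  obtain ⟨H₁, hH₁⟩ := exists_hasDerivAt_of_continuousOn_Ioo hab hGv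
  obtain ⟨K, hK⟩ := exists_hasDerivAt_of_continuousOn_Ioo hab hinv.continuousOn
  have lH₁ : LocallyIntegrableOn H₁ (Ioo a b) := ContinuousOn.locallyIntegrableOn
    (fun x hx => (hH₁ x hx).continuousAt.continuousWithinAt) measurableSet_Ioo
  have lK : LocallyIntegrableOn K (Ioo a b) := ContinuousOn.locallyIntegrableOn
    (fun x hx => (hK x hx).continuousAt.continuousWithinAt) measurableSet_Ioo
  -- `H₁` solves the equation with flux `G`, and `K` has flux `1`; the constant `D` is chosen so
  -- that `h - H₁ + D K` has zero weak derivative.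
  set D := ∫ x, (h x - H₁ x) * deriv (fun y => v y ^ 2 * χ₀ y) x with hD
  have hmain : ∀ ψ, IsRealTest a b ψ →
      ∫ x, (h x - H₁ x + D * K x) * deriv ψ x = 0 := by
    intro ψ hψ
    have hq := hψ.mul_left hinv
    -- An arbitrary `ψ` need not have the form `v² φ'`, because `ψ / v²` may have nonzero mean.
    -- Subtracting `m χ₀` from it removes the obstruction.
    set m := ∫ x, (v x ^ 2)⁻¹ * ψ x with hm
    obtain ⟨φ, hφ, hφ'⟩ := IsRealTest.exists_deriv_eq hab (hq.sub (hχ₀.const_mul m)) (by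
      rw [integral_sub hq.integrable (hχ₀.const_mul m).integrable, integral_const_mul, h1]
      ring)
    have w := weak φ hφ
    have e1 : (fun y => v y ^ 2 * deriv φ y) = fun y => ψ y - m * (v y ^ 2 * χ₀ y) := by
      funext y
      rw [hφ']
      by_cases hy : y ∈ Ioo a b
      · have := (hpos y hy).ne'
        field_simp
      · simp [hψ.eq_zero hy, hχ₀.eq_zero hy]
    have e2 : ∀ x, deriv (fun y => v y ^ 2 * deriv φ y) x
        = deriv ψ x - m * deriv (fun y => v y ^ 2 * χ₀ y) x := by
      intro x
      rw [e1]
      exact ((hψ.hasDerivAt x).sub ((hψ₀.hasDerivAt x).const_mul m)).deriv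
    have e3 : ∀ x, G x * deriv φ x
        = G x * (v x ^ 2)⁻¹ * ψ x - m * (G x * (v x ^ 2)⁻¹ * (v x ^ 2 * χ₀ x)) := by
      intro x
      rw [hφ']
      by_cases hy : x ∈ Ioo a b
      · have := (hpos x hy).ne'
        field_simp
      · simp [hψ.eq_zero hy, hχ₀.eq_zero hy]
    have lGv := hGv.locallyIntegrableOn (μ := volume) measurableSet_Ioo
    have e4 : ∀ x, h x * deriv (fun y => v y ^ 2 * deriv φ y) x
        = h x * deriv ψ x - m * (h x * deriv (fun y => v y ^ 2 * χ₀ y) x) := by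
      intro x; rw [e2]; ring
    simp_rw [e4, e3] at w
    rw [integral_sub (hψ.deriv.integrable_mul hh) ((hψ₀.deriv.integrable_mul hh).const_mul m),
      integral_sub (hψ.integrable_mul lGv) ((hψ₀.integrable_mul lGv).const_mul m),
      integral_const_mul, integral_const_mul] at w
    have p1 := hψ.integral_mul_deriv hH₁ hGv
    have p2 := hψ₀.integral_mul_deriv hH₁ hGv
    have p3 := hψ.integral_mul_deriv hK hinv.continuousOn
    have e5 : D = (∫ x, h x * deriv (fun y => v y ^ 2 * χ₀ y) x)
        - ∫ x, H₁ x * deriv (fun y => v y ^ 2 * χ₀ y) x := by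
      rw [hD, ← integral_sub (hψ₀.deriv.integrable_mul hh) (hψ₀.deriv.integrable_mul lH₁)]
      simp_rw [sub_mul]
    have e6 : ∀ x, (h x - H₁ x + D * K x) * deriv ψ x
        = (h x * deriv ψ x - H₁ x * deriv ψ x) + D * (K x * deriv ψ x) := by
      intro x; ring
    simp_rw [e6]
    have i1 := hψ.deriv.integrable_mul hh
    have i2 := hψ.deriv.integrable_mul lH₁
    rw [integral_add (f := fun x => h x * deriv ψ x - H₁ x * deriv ψ x) (i1.sub i2)
        ((hψ.deriv.integrable_mul lK).const_mul D),
      integral_sub i1 i2, integral_const_mul, p3, ← hm]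
    rw [p2] at e5
    rw [p1]
    linear_combination w - m * e5
  obtain ⟨C, hC⟩ := ae_eq_const_of_integral_mul_deriv_eq_zero hab
    ((hh.sub lH₁).add (lK.continuousOn_mul continuousOn_const
      isOpen_Ioo.isLocallyClosed)) hmain
  refine ⟨-D, fun x => H₁ x - D * K x + C, fun x hx => ?_, ?_⟩
  · convert! ((hH₁ x hx).sub ((hK x hx).const_mul D)).add_const C using 1
    rw [div_eq_mul_inv]; ring
  · filter_upwards [hC] with x hx hxI
    have := hx hxI
    simp only [Pi.add_apply, Pi.sub_apply] at this
    linarith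

end

/-! ### Growth at a quadratic zero of the weight. -/

section

open Set Filter Topology
open scoped ContDiff

/-- The function `F - κ/3 (b - x)⁻³` is nondecreasing. Past the midpoint of `x₁` and `b`, the
subtracted term at `x₁` is at most an eighth of the one at `x`, which leaves more than `κ/6`. -/
theorem growth_of_deriv_ge {x₀ b κ : ℝ} {F F' : ℝ → ℝ}
    (hF : ∀ x ∈ Ioo x₀ b, HasDerivAt F (F' x) x)
    (hF' : ∀ x ∈ Ioo x₀ b, κ * ((b - x)⁻¹) ^ 4 ≤ F' x) (hκ : 0 < κ)
    {x₁ x : ℝ} (hx₁ : x₁ ∈ Ioo x₀ b) (hx : x ∈ Ioo ((x₁ + b) / 2) b) :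
    F x₁ + κ / 6 * ((b - x)⁻¹) ^ 3 ≤ F x := by
  have hd : ∀ y ∈ Ioo x₀ b, HasDerivAt (fun y => F y - κ / 3 * ((b - y)⁻¹) ^ 3)
      (F' y - κ * ((b - y)⁻¹) ^ 4) y := by
    intro y hy
    have hne : b - y ≠ 0 := (sub_pos.2 hy.2).ne'
    have h1 : HasDerivAt (fun y => (b - y)⁻¹) (-(-1) / (b - y) ^ 2) y :=
      ((hasDerivAt_id y).const_sub b).fun_inv hne
    convert! (hF y hy).sub ((h1.fun_pow 3).const_mul (κ / 3)) using 1
    simp only [neg_neg, one_div, inv_pow]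
    field_simp
    norm_num
    field_simp
  have hmono : MonotoneOn (fun y => F y - κ / 3 * ((b - y)⁻¹) ^ 3) (Ioo x₀ b) := by
    refine monotoneOn_of_deriv_nonneg (convex_Ioo _ _)
      (fun y hy => (hd y hy).continuousAt.continuousWithinAt) ?_ ?_
    · rw [interior_Ioo]
      exact fun y hy => (hd y hy).differentiableAt.differentiableWithinAt
    · rw [interior_Ioo]
      intro y hy
      rw [(hd y hy).deriv]
      linarith [hF' y hy]
  have hx₁b := hx₁.2
  have hxb := hx.2
  have hlt : x₁ ≤ x := by linarith [hx.1]
  have h2 := hmono hx₁ ⟨hx₁.1.trans_le hlt, hxb⟩ hlt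
  simp only at h2
  have h3 : (b - x₁)⁻¹ ≤ 1 / 2 * (b - x)⁻¹ := by
    rw [← one_div, ← one_div, div_mul_div_comm, one_mul]
    exact one_div_le_one_div_of_le (by linarith) (by linarith [hx.1])
  have h4 : 0 < (b - x₁)⁻¹ := inv_pos.2 (by linarith)
  have h5 : ((b - x₁)⁻¹) ^ 3 ≤ (1 / 2 * (b - x)⁻¹) ^ 3 := by gcongr
  have h6 : 0 < ((b - x)⁻¹) ^ 3 := pow_pos (inv_pos.2 (by linarith)) 3
  have h7 : κ * ((b - x₁)⁻¹) ^ 3 ≤ κ * (1 / 2 * (b - x)⁻¹) ^ 3 := by gcongr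
  nlinarith [mul_pos hκ h6]

/-- Comparison with the logarithmic divergence of `(b - x)⁻¹`. -/
theorem not_integrableOn_of_inv_le {x₀ b κ : ℝ} (hb : x₀ < b) (hκ : 0 < κ) {F : ℝ → ℝ}
    (hF : ∀ x ∈ Ioo x₀ b, κ * (b - x)⁻¹ ≤ F x) : ¬ IntegrableOn F (Ioo x₀ b) := by
  intro hi
  have h1 : IntegrableOn (fun x => (x - b)⁻¹) (Ioo x₀ b) := by
    refine Integrable.mono' (hi.const_mul κ⁻¹)
      (measurable_id.sub_const b).inv.aestronglyMeasurable ?_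
    filter_upwards [ae_restrict_mem measurableSet_Ioo] with x hx
    have h2 : 0 < b - x := sub_pos.2 hx.2
    rw [norm_inv, Real.norm_eq_abs, abs_sub_comm, abs_of_pos h2]
    rw [inv_mul_eq_div, le_div_iff₀ hκ, mul_comm]
    exact hF x hx
  have h2 : IntervalIntegrable (fun x => (x - b)⁻¹) volume x₀ b := by
    rwa [intervalIntegrable_iff_integrableOn_Ioo_of_le hb.le]
  rcases intervalIntegrable_sub_inv_iff.1 h2 with h3 | h3
  · exact hb.ne h3
  · exact h3 right_mem_uIcc

section Endpoint

variable {x₀ b c C : ℝ} {v H P : ℝ → ℝ}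

/-- A solution with flux bounded below near a quadratic zero of the weight is not in the
weighted `L²` space. -/
theorem not_integrableOn_of_flux_ge {δ : ℝ} (hb : x₀ < b) (hc : 0 < c) (hδ : 0 < δ)
    (hlb : ∀ x ∈ Ioo x₀ b, c * (b - x) ^ 2 ≤ v x) (hub : ∀ x ∈ Ioo x₀ b, v x ≤ C * (b - x) ^ 2)
    (hH : ∀ x ∈ Ioo x₀ b, HasDerivAt H (P x / v x ^ 2) x)
    (hPH : ∀ x ∈ Ioo x₀ b, δ ≤ P x * H x) :
    ¬ IntegrableOn (fun x => v x * H x ^ 2) (Ioo x₀ b) := by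
  obtain ⟨x₁, hx₁⟩ := exists_between hb
  have hC : 0 < C := by
    have h0 : 0 < (b - x₁) ^ 2 := pow_pos (sub_pos.2 hx₁.2) 2
    by_contra hC
    nlinarith [hlb x₁ hx₁, hub x₁ hx₁]
  -- Working with `H²` avoids any sign information on `H`: its derivative is at least a multiple of
  -- `(b - x)⁻⁴`, so `H²` dominates `(b - x)⁻³` and `v H²` dominates `(b - x)⁻¹`.
  have hd : ∀ x ∈ Ioo x₀ b, HasDerivAt (fun x => H x ^ 2) (2 * (P x * H x) / v x ^ 2) x := by
    intro x hx
    convert! (hH x hx).fun_pow 2 using 1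
    simp; ring
  have hge : ∀ x ∈ Ioo x₀ b, 2 * δ / C ^ 2 * ((b - x)⁻¹) ^ 4 ≤ 2 * (P x * H x) / v x ^ 2 := by
    intro x hx
    have h0 : 0 < b - x := sub_pos.2 hx.2
    have hv : 0 < v x := (by positivity : 0 < c * (b - x) ^ 2).trans_le (hlb x hx)
    have h1 : v x ^ 2 ≤ (C * (b - x) ^ 2) ^ 2 := by
      have := hub x hx
      gcongr
    calc 2 * δ / C ^ 2 * ((b - x)⁻¹) ^ 4 = 2 * δ / (C * (b - x) ^ 2) ^ 2 := by
          field_simp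
      _ ≤ 2 * δ / v x ^ 2 := by gcongr
      _ ≤ 2 * (P x * H x) / v x ^ 2 := by
          have := hPH x hx
          gcongr
  have hκ : 0 < 2 * δ / C ^ 2 := by positivity
  set κ := 2 * δ / C ^ 2
  have hmid : (x₁ + b) / 2 < b := by linarith [hx₁.2]
  have hsub : Ioo ((x₁ + b) / 2) b ⊆ Ioo x₀ b := Ioo_subset_Ioo_left (by linarith [hx₁.1, hx₁.2])
  intro hi
  refine not_integrableOn_of_inv_le (κ := c * (κ / 6)) hmid (by positivity) (fun x hx => ?_)
    (hi.mono_set hsub)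
  have hg := growth_of_deriv_ge hd hge hκ hx₁ hx
  have hxx := hsub hx
  have h0 : 0 < b - x := sub_pos.2 hx.2
  have h2 : κ / 6 * ((b - x)⁻¹) ^ 3 ≤ H x ^ 2 := by linarith [sq_nonneg (H x₁)]
  calc c * (κ / 6) * (b - x)⁻¹ = c * (b - x) ^ 2 * (κ / 6 * ((b - x)⁻¹) ^ 3) := by
        field_simp
    _ ≤ v x * H x ^ 2 := by
        have := hlb x hxx
        exact mul_le_mul this h2 (by positivity) (le_trans (by positivity) this)

/-- If `k > 0` then `P ≥ k/2` near `b`, so `H'` is at least a multiple of `(b - x)⁻⁴` and `H` tends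
to infinity. Once `H ≥ 1`, the product `P H` is at least `k/2`, and `not_integrableOn_of_flux_ge`
contradicts integrability. -/
theorem flux_limit_nonpos {k : ℝ} (hb : x₀ < b) (hc : 0 < c)
    (hlb : ∀ x ∈ Ioo x₀ b, c * (b - x) ^ 2 ≤ v x) (hub : ∀ x ∈ Ioo x₀ b, v x ≤ C * (b - x) ^ 2)
    (hH : ∀ x ∈ Ioo x₀ b, HasDerivAt H (P x / v x ^ 2) x)
    (hP : Tendsto P (𝓝[<] b) (𝓝 k))
    (hi : IntegrableOn (fun x => v x * H x ^ 2) (Ioo x₀ b)) : k ≤ 0 := by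
  by_contra! hk
  have hev : ∀ᶠ x in 𝓝[<] b, k / 2 < P x := hP.eventually (lt_mem_nhds (by linarith))
  obtain ⟨x₂, hx₂, hP2⟩ := (mem_nhdsLT_iff_exists_Ioo_subset' hb).1 hev
  have hx₂' : x₂ < b := hx₂
  set y₀ := max x₀ x₂
  have hy₀ : y₀ < b := max_lt hb hx₂
  have hs : Ioo y₀ b ⊆ Ioo x₀ b := Ioo_subset_Ioo_left (le_max_left _ _)
  have hs2 : Ioo y₀ b ⊆ Ioo x₂ b := Ioo_subset_Ioo_left (le_max_right _ _)
  obtain ⟨x₁, hx₁⟩ := exists_between hy₀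
  have hC : 0 < C := by
    have h0 : 0 < (b - x₁) ^ 2 := pow_pos (sub_pos.2 hx₁.2) 2
    by_contra hC
    nlinarith [hlb x₁ (hs hx₁), hub x₁ (hs hx₁)]
  have hge : ∀ x ∈ Ioo y₀ b, k / 2 / C ^ 2 * ((b - x)⁻¹) ^ 4 ≤ P x / v x ^ 2 := by
    intro x hx
    have h0 : 0 < b - x := sub_pos.2 hx.2
    have hv : 0 < v x := (by positivity : 0 < c * (b - x) ^ 2).trans_le (hlb x (hs hx))
    have h1 : v x ^ 2 ≤ (C * (b - x) ^ 2) ^ 2 := by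
      have := hub x (hs hx)
      gcongr
    calc k / 2 / C ^ 2 * ((b - x)⁻¹) ^ 4 = k / 2 / (C * (b - x) ^ 2) ^ 2 := by
          field_simp
      _ ≤ k / 2 / v x ^ 2 := by gcongr
      _ ≤ P x / v x ^ 2 := by
          have : k / 2 ≤ P x := (hP2 (hs2 hx)).le
          gcongr
  have hκ : 0 < k / 2 / C ^ 2 := by positivity
  set κ := k / 2 / C ^ 2
  have hlim : Tendsto (fun x => H x₁ + κ / 6 * ((b - x)⁻¹) ^ 3) (𝓝[<] b) atTop := by
    refine tendsto_atTop_add_const_left _ _ (Tendsto.const_mul_atTop (by positivity) ?_)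
    refine (tendsto_pow_atTop (by norm_num)).comp (tendsto_inv_nhdsGT_zero.comp ?_)
    refine tendsto_nhdsWithin_iff.2 ⟨?_, ?_⟩
    · have : Tendsto (fun x => b - x) (𝓝 b) (𝓝 (b - b)) := by
        exact (continuous_const.sub continuous_id).tendsto b
      rw [sub_self] at this
      exact this.mono_left nhdsWithin_le_nhds
    · filter_upwards [self_mem_nhdsWithin] with x hx
      exact sub_pos.2 (mem_Iio.1 hx)
  obtain ⟨x₃, hx₃, hH3⟩ := (mem_nhdsLT_iff_exists_Ioo_subset' hb).1 (hlim.eventually_ge_atTop 1)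
  have hx₃' : x₃ < b := hx₃
  set z₀ := max ((x₁ + b) / 2) x₃
  have hz₀ : z₀ < b := max_lt (by linarith [hx₁.2]) hx₃
  have hz1 : Ioo z₀ b ⊆ Ioo ((x₁ + b) / 2) b := Ioo_subset_Ioo_left (le_max_left _ _)
  have hz2 : Ioo z₀ b ⊆ Ioo x₃ b := Ioo_subset_Ioo_left (le_max_right _ _)
  have hz3 : Ioo z₀ b ⊆ Ioo y₀ b :=
    hz1.trans (Ioo_subset_Ioo_left (by linarith [hx₁.1, hx₁.2]))
  refine not_integrableOn_of_flux_ge (δ := k / 2) hz₀ hc (by positivity)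
    (fun x hx => hlb x (hs (hz3 hx))) (fun x hx => hub x (hs (hz3 hx)))
    (fun x hx => hH x (hs (hz3 hx))) (fun x hx => ?_) (hi.mono_set (hz3.trans hs))
  have h1 := growth_of_deriv_ge (fun y hy => hH y (hs hy)) hge hκ hx₁ (hz1 hx)
  have h2 : 1 ≤ H x := le_trans (hH3 (hz2 hx)) h1
  have h3 : k / 2 ≤ P x := (hP2 (hs2 (hz3 hx))).le
  nlinarith

/-- The hypotheses are invariant under `(H, P) ↦ (-H, -P)`, so the one-sided bound applies to both
signs. -/
theorem flux_limit_eq_zero {k : ℝ} (hb : x₀ < b) (hc : 0 < c)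
    (hlb : ∀ x ∈ Ioo x₀ b, c * (b - x) ^ 2 ≤ v x) (hub : ∀ x ∈ Ioo x₀ b, v x ≤ C * (b - x) ^ 2)
    (hH : ∀ x ∈ Ioo x₀ b, HasDerivAt H (P x / v x ^ 2) x)
    (hP : Tendsto P (𝓝[<] b) (𝓝 k))
    (hi : IntegrableOn (fun x => v x * H x ^ 2) (Ioo x₀ b)) : k = 0 := by
  refine le_antisymm (flux_limit_nonpos hb hc hlb hub hH hP hi) ?_
  have := flux_limit_nonpos (H := fun x => -H x) (P := fun x => -P x) (k := -k) hb hc hlb hub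
    (fun x hx => by simpa only [neg_div] using (hH x hx).fun_neg) hP.neg (by simpa using hi)
  linarith

/-- Near the endpoint there are points where `P H` is arbitrarily small. -/
theorem exists_flux_lt {δ : ℝ} (hb : x₀ < b) (hc : 0 < c) (hδ : 0 < δ)
    (hlb : ∀ x ∈ Ioo x₀ b, c * (b - x) ^ 2 ≤ v x) (hub : ∀ x ∈ Ioo x₀ b, v x ≤ C * (b - x) ^ 2)
    (hH : ∀ x ∈ Ioo x₀ b, HasDerivAt H (P x / v x ^ 2) x)
    (hi : IntegrableOn (fun x => v x * H x ^ 2) (Ioo x₀ b)) {y : ℝ} (hy : y < b) :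
    ∃ x ∈ Ioo x₀ b, y < x ∧ P x * H x < δ := by
  by_contra! hcon
  have hs : Ioo (max x₀ y) b ⊆ Ioo x₀ b := Ioo_subset_Ioo_left (le_max_left _ _)
  exact not_integrableOn_of_flux_ge (max_lt hb hy) hc hδ (fun x hx => hlb x (hs hx))
    (fun x hx => hub x (hs hx)) (fun x hx => hH x (hs hx))
    (fun x hx => hcon x (hs hx) ((le_max_right _ _).trans_lt hx.1)) (hi.mono_set hs)

end Endpoint

end

/-! ### The degenerate Sturm–Liouville operator in flux form. -/

section

open Set Filter Topology
open scoped ContDiff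

/-- `v` is an even profile on `(-L, L)`, smooth and positive inside and vanishing to exactly
second order at `±L`. -/
structure IsQuadraticProfile (L : ℝ) (v : ℝ → ℝ) : Prop where
  length_pos : 0 < L
  continuous : Continuous v
  smooth : ContDiffOn ℝ ∞ v (Ioo (-L) L)
  pos : ∀ x ∈ Ioo (-L) L, 0 < v x
  even : ∀ x, v (-x) = v x
  bounds : ∃ x₀ c C, 0 ≤ x₀ ∧ x₀ < L ∧ 0 < c ∧
    ∀ x ∈ Ioo x₀ L, c * (L - x) ^ 2 ≤ v x ∧ v x ≤ C * (L - x) ^ 2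

/-- `u` is a weak solution in `L²(-L, L)` of `-v^{-1/2} (v² (v^{-1/2} u)')' = g`. -/
structure IsWeakPair (L : ℝ) (v u g : ℝ → ℝ) : Prop where
  memLp_left : MemLp u 2 (volume.restrict (Ioo (-L) L))
  memLp_right : MemLp g 2 (volume.restrict (Ioo (-L) L))
  weak : ∀ φ, IsRealTest (-L) L φ →
    ∫ x in Ioo (-L) L, g x * (√(v x) * φ x)
      = -∫ x in Ioo (-L) L, u x / √(v x) * deriv (fun y => v y ^ 2 * deriv φ y) x

theorem integrableOn_comp_neg_Ioo {L : ℝ} {f : ℝ → ℝ} (hf : IntegrableOn f (Ioo (-L) L)) :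
    IntegrableOn (fun x => f (-x)) (Ioo (-L) L) := by
  have := (integrableOn_image_iff_integrableOn_abs_deriv_smul (s := Ioo (-L) L)
    (f := fun x => -x) (f' := fun _ => -1) measurableSet_Ioo
    (fun x _ => (hasDerivAt_neg x).hasDerivWithinAt) neg_injective.injOn f).1 (by simpa using hf)
  simpa using this

namespace IsQuadraticProfile

variable {L : ℝ} {v u g : ℝ → ℝ}

/-- The flux form of the equation: `u = √v H` with `v² H' = P`, `P' = -√v g`, `P (±L) = 0`. -/
theorem exists_flux (hv : IsQuadraticProfile L v) (hw : IsWeakPair L v u g) :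
    Integrable ((Ioo (-L) L).indicator fun x => g x * √(v x)) ∧
    ∃ (k : ℝ) (H P : ℝ → ℝ),
      (∀ x, P x = k - ∫ t in (0 : ℝ)..x, (Ioo (-L) L).indicator (fun t => g t * √(v t)) t) ∧
      (∀ x ∈ Ioo (-L) L, HasDerivAt H (P x / v x ^ 2) x) ∧
      (∀ᵐ x, x ∈ Ioo (-L) L → u x = √(v x) * H x) ∧ P L = 0 ∧ P (-L) = 0 ∧
      IntegrableOn (fun x => v x * H x ^ 2) (Ioo (-L) L) := by
  have hL := hv.length_pos
  have hab : -L < L := by linarith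
  have hsq : Continuous fun x => √(v x) := hv.continuous.sqrt
  have hsqpos : ∀ x ∈ Ioo (-L) L, 0 < √(v x) := fun x hx => Real.sqrt_pos.2 (hv.pos x hx)
  have hui : IntegrableOn u (Ioo (-L) L) := hw.memLp_left.integrable (by norm_num)
  have hgi : IntegrableOn g (Ioo (-L) L) := hw.memLp_right.integrable (by norm_num)
  have hgs : IntegrableOn (fun x => g x * √(v x)) (Ioo (-L) L) := by
    rw [← integrableOn_Icc_iff_integrableOn_Ioo] at hgi ⊢
    exact hgi.mul_continuousOn hsq.continuousOn isCompact_Icc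
  set K : ℝ → ℝ := (Ioo (-L) L).indicator fun x => g x * √(v x) with hK
  have hKi : Integrable K := (integrable_indicator_iff measurableSet_Ioo).2 hgs
  refine ⟨hKi, ?_⟩
  set G : ℝ → ℝ := fun x => ∫ t in (0 : ℝ)..x, K t with hG
  have hGc : Continuous G := intervalIntegral.continuous_primitive
    (fun a b => hKi.intervalIntegrable) 0
  have hhl : LocallyIntegrableOn (fun x => u x / √(v x)) (Ioo (-L) L) := by
    simp_rw [div_eq_mul_inv]
    exact hui.locallyIntegrableOn.mul_continuousOn
      (hsq.continuousOn.inv₀ fun x hx => (hsqpos x hx).ne') isOpen_Ioo.isLocallyClosed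
  obtain ⟨k, H, hH, hHu⟩ := exists_hasDerivAt_of_weak_sturmLiouville hab hv.smooth hv.pos hhl
    (G := fun x => -G x) hGc.neg.continuousOn (by
      intro φ hφ
      have h1 := hw.weak φ hφ
      have h2 := hφ.integral_primitive_mul_deriv hab hKi 0
      have h3 : ∫ x in Ioo (-L) L, g x * (√(v x) * φ x) = ∫ x, K x * φ x := by
        rw [← integral_indicator measurableSet_Ioo]
        congr 1
        funext x
        by_cases hx : x ∈ Ioo (-L) L
        · simp [hK, hx, mul_assoc]
        · rw [hK, indicator_of_notMem hx, indicator_of_notMem hx, zero_mul]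
      have hd := (hφ.deriv.mul_left (hv.smooth.pow 2)).deriv
      have h4 : ∫ x in Ioo (-L) L, u x / √(v x) * deriv (fun y => v y ^ 2 * deriv φ y) x
          = ∫ x, u x / √(v x) * deriv (fun y => v y ^ 2 * deriv φ y) x := by
        refine setIntegral_eq_integral_of_forall_compl_eq_zero fun x hx => ?_
        have := hd.eq_zero hx
        rw [this, mul_zero]
      rw [h3, h4] at h1
      simp only [neg_mul, integral_neg, neg_neg]
      linarith)
  have hu : ∀ᵐ x, x ∈ Ioo (-L) L → u x = √(v x) * H x := by
    filter_upwards [hHu] with x hx hxI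
    rw [← hx hxI]
    have := (hsqpos x hxI).ne'
    field_simp
  have hvH : IntegrableOn (fun x => v x * H x ^ 2) (Ioo (-L) L) := by
    refine Integrable.congr hw.memLp_left.integrable_sq ?_
    rw [EventuallyEq, ae_restrict_iff' measurableSet_Ioo]
    filter_upwards [hu] with x hx hxI
    rw [hx hxI, mul_pow, Real.sq_sqrt (hv.pos x hxI).le]
  have hPc : Continuous fun x => k - G x := continuous_const.sub hGc
  have hHP : ∀ x ∈ Ioo (-L) L, HasDerivAt H ((k - G x) / v x ^ 2) x := by
    intro x hx
    convert! hH x hx using 1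
    ring
  obtain ⟨x₀, c, C, hx₀, hx₀L, hc, hbd⟩ := hv.bounds
  have hsub : Ioo x₀ L ⊆ Ioo (-L) L := Ioo_subset_Ioo_left (by linarith)
  refine ⟨k, H, fun x => k - G x, fun x => rfl, hHP, hu, ?_, ?_, hvH⟩
  · exact flux_limit_eq_zero hx₀L hc (fun x hx => (hbd x hx).1) (fun x hx => (hbd x hx).2)
      (fun x hx => hHP x (hsub hx)) (hPc.continuousWithinAt.tendsto) (hvH.mono_set hsub)
  -- The left edge is reduced to the right one by reflection, which changes the sign of the flux
  -- because `v` is even.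
  · have h0 := flux_limit_eq_zero (H := fun x => H (-x)) (P := fun x => -(k - G (-x)))
      (k := -(k - G (-L))) hx₀L hc (fun x hx => (hbd x hx).1) (fun x hx => (hbd x hx).2)
      (fun x hx => ?_) ((hPc.comp continuous_neg).neg.continuousWithinAt.tendsto) ?_
    · linarith
    · have hx' : -x ∈ Ioo (-L) L := ⟨by linarith [(hsub hx).2], by linarith [(hsub hx).1]⟩
      convert! (hHP (-x) hx').comp x (hasDerivAt_neg x) using 1
      rw [hv.even]; ring
    · have h1 := integrableOn_comp_neg_Ioo hvH
      simp only [hv.even] at h1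
      exact h1.mono_set hsub

/-- The integral is the total drop of the flux across the interval, and the flux vanishes at both
ends. With `v = Φ²` this is orthogonality of `Φ` to the range. -/
theorem integral_mul_sqrt_eq_zero (hv : IsQuadraticProfile L v) (hw : IsWeakPair L v u g) :
    ∫ x in Ioo (-L) L, g x * √(v x) = 0 := by
  obtain ⟨hi, k, H, P, hP, -, -, h1, h2, -⟩ := hv.exists_flux hw
  have hL := hv.length_pos
  rw [hP] at h1 h2
  have h3 : ∫ t in (-L)..L, (Ioo (-L) L).indicator (fun t => g t * √(v t)) t = 0 := by
    rw [← intervalIntegral.integral_interval_sub_left (a := 0) hi.intervalIntegrable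
      hi.intervalIntegrable]
    linarith
  rw [intervalIntegral.integral_of_le (by linarith), integral_Ioc_eq_integral_Ioo,
    setIntegral_indicator measurableSet_Ioo, inter_self] at h3
  exact h3

/-- Without a source the flux is constant, hence zero by its edge values, and so `H' = 0`. -/
theorem eq_const_mul_sqrt (hv : IsQuadraticProfile L v) (hw : IsWeakPair L v u g)
    (hg : g =ᵐ[volume.restrict (Ioo (-L) L)] 0) :
    ∃ k : ℝ, u =ᵐ[volume.restrict (Ioo (-L) L)] fun x => k * √(v x) := by
  obtain ⟨hi, k, H, P, hP, hH, hu, h1, h2, -⟩ := hv.exists_flux hw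
  have hL := hv.length_pos
  have h0 : ∀ x, P x = k := by
    intro x
    rw [hP, sub_eq_self]
    refine intervalIntegral.integral_zero_ae ?_
    rw [EventuallyEq, ae_restrict_iff' measurableSet_Ioo] at hg
    filter_upwards [hg] with t ht _
    by_cases htI : t ∈ Ioo (-L) L
    · simp [htI, ht htI]
    · rw [indicator_of_notMem htI]
  have hk : k = 0 := by rw [← h0 L, h1]
  have hconst : ∀ x ∈ Ioo (-L) L, H x = H 0 := by
    intro x hx
    refine isOpen_Ioo.is_const_of_deriv_eq_zero isPreconnected_Ioo
      (fun y hy => (hH y hy).differentiableAt.differentiableWithinAt) (fun y hy => ?_) hx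
      ⟨by linarith, hL⟩
    rw [(hH y hy).deriv, h0, hk]
    simp
  refine ⟨H 0, ?_⟩
  rw [EventuallyEq, ae_restrict_iff' measurableSet_Ioo]
  filter_upwards [hu] with x hx hxI
  rw [hx hxI, hconst x hxI, mul_comm]

/-- On a compact subinterval, integration by parts gives `∫ g u = P(a) H(a) - P(b) H(b) + ∫ P² /
v²`. The products `P H` need not be shown to converge at the edges: points arbitrarily close to each
edge with a favourable bound, supplied by `exists_flux_lt`, suffice. -/
theorem integral_mul_nonneg (hv : IsQuadraticProfile L v) (hw : IsWeakPair L v u g) :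
    0 ≤ ∫ x in Ioo (-L) L, g x * u x := by
  obtain ⟨hi, k, H, P, hP, hH, hu, h1, h2, hvH⟩ := hv.exists_flux hw
  have hL := hv.length_pos
  set K : ℝ → ℝ := (Ioo (-L) L).indicator fun x => g x * √(v x) with hK
  have hPc : Continuous P := by
    have : P = fun x => k - ∫ t in (0 : ℝ)..x, K t := funext hP
    rw [this]
    exact continuous_const.sub (intervalIntegral.continuous_primitive
      (fun a b => hi.intervalIntegrable) 0)
  have hPac : ∀ a b, AbsolutelyContinuousOnInterval P a b := by
    intro a b
    have h0 := (hi.intervalIntegrable (a := min 0 (min a b)) (b := max 0 (max a b))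
      ).absolutelyContinuousOnInterval_intervalIntegral (c := 0) (by
        rw [uIcc_of_le (by simp)]; simp)
    have h3 : AbsolutelyContinuousOnInterval (fun x => ∫ t in (0 : ℝ)..x, K t) a b := by
      refine h0.mono ?_
      rw [uIcc_of_le (a := min 0 (min a b)) (by simp)]
      exact Icc_subset_Icc (by simp) (by simp)
    have h4 : AbsolutelyContinuousOnInterval (fun _ => k) a b :=
      (contDiff_const (n := 1)).contDiffOn.absolutelyContinuousOnInterval
    have : P = fun x => k - ∫ t in (0 : ℝ)..x, K t := funext hP
    rw [this]
    exact h4.fun_sub h3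
  set Q : ℝ → ℝ := (Ioo (-L) L).indicator fun x => g x * u x with hQ
  have hQi : Integrable Q :=
    (integrable_indicator_iff measurableSet_Ioo).2 (hw.memLp_right.integrable_mul hw.memLp_left)
  set F : ℝ → ℝ := fun x => ∫ t in (0 : ℝ)..x, Q t with hF
  have hFc : Continuous F := intervalIntegral.continuous_primitive
    (fun a b => hQi.intervalIntegrable) 0
  have hFsub : ∀ a b, F b - F a = ∫ t in a..b, Q t := fun a b =>
    intervalIntegral.integral_interval_sub_left hQi.intervalIntegrable hQi.intervalIntegrable
  have htot : ∫ x in Ioo (-L) L, g x * u x = F L - F (-L) := by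
    rw [hFsub, intervalIntegral.integral_of_le (by linarith), integral_Ioc_eq_integral_Ioo,
      setIntegral_indicator measurableSet_Ioo, inter_self]
  have hHcont : ContinuousOn (fun x => P x / v x ^ 2) (Ioo (-L) L) :=
    hPc.continuousOn.div (hv.continuous.pow 2).continuousOn
      fun x hx => (pow_pos (hv.pos x hx) 2).ne'
  have hpart : ∀ a b, -L < a → a ≤ b → b < L → P a * H a - P b * H b ≤ F b - F a := by
    intro a b ha hab hb
    have hsub : uIcc a b ⊆ Ioo (-L) L := by
      rw [uIcc_of_le hab]
      exact Icc_subset_Ioo ha hb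
    have hC1 : ContDiffOn ℝ 1 H (Ioo (-L) L) := by
      rw [show (1 : WithTop ℕ∞) = 0 + 1 from rfl,
        contDiffOn_succ_iff_deriv_of_isOpen isOpen_Ioo]
      refine ⟨fun x hx => (hH x hx).differentiableAt.differentiableWithinAt, by simp, ?_⟩
      rw [contDiffOn_zero]
      exact hHcont.congr fun x hx => (hH x hx).deriv
    have hHac : AbsolutelyContinuousOnInterval H a b :=
      (hC1.mono hsub).absolutelyContinuousOnInterval
    have e := hHac.integral_mul_deriv_eq_deriv_mul (hPac a b)
    have e1 : ∫ x in a..b, H x * deriv P x = -∫ x in a..b, Q x := by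
      rw [← intervalIntegral.integral_neg]
      refine intervalIntegral.integral_congr_ae ?_
      filter_upwards [_root_.LocallyIntegrable.ae_hasDerivAt_integral hi.locallyIntegrable, hu]
        with x hx hux hxab
      have hxI := hsub (uIoc_subset_uIcc hxab)
      have hdP : HasDerivAt P (-K x) x := by
        have : P = fun x => k - ∫ t in (0 : ℝ)..x, K t := funext hP
        rw [this]
        exact (hx 0).const_sub k
      rw [hdP.deriv, hQ, hK, indicator_of_mem hxI, indicator_of_mem hxI, hux hxI]
      ring
    have e2 : 0 ≤ ∫ x in a..b, deriv H x * P x := by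
      refine intervalIntegral.integral_nonneg hab fun x hx => ?_
      rw [(hH x (hsub (by rwa [uIcc_of_le hab]))).deriv, div_mul_eq_mul_div]
      exact div_nonneg (mul_self_nonneg _) (sq_nonneg _)
    rw [hFsub]
    rw [e1] at e
    linarith [mul_comm (P a) (H a), mul_comm (P b) (H b)]
  obtain ⟨x₀, c, C, hx₀, hx₀L, hc, hbd⟩ := hv.bounds
  have hsub : Ioo x₀ L ⊆ Ioo (-L) L := Ioo_subset_Ioo_left (by linarith)
  by_contra! hneg
  rw [htot] at hneg
  -- Four errors are allowed, each below `τ/4`: the two tails of the integral and the two boundary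
  -- products.
  set τ := -(F L - F (-L)) with hτ
  have hτpos : 0 < τ := by linarith
  have ev1 : ∀ᶠ x in 𝓝[<] L, F x < F L + τ / 4 :=
    (hFc.continuousWithinAt.tendsto).eventually (gt_mem_nhds (by linarith))
  have ev2 : ∀ᶠ x in 𝓝[<] L, F (-L) - τ / 4 < F (-x) :=
    ((hFc.comp continuous_neg).continuousWithinAt.tendsto).eventually
      (lt_mem_nhds (by simp only [Function.comp]; linarith))
  obtain ⟨y, hy, hyF⟩ := (mem_nhdsLT_iff_exists_Ioo_subset' hx₀L).1 (ev1.and ev2)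
  obtain ⟨b, hb, hyb, hPb⟩ := exists_flux_lt (δ := τ / 4) hx₀L hc (by linarith)
    (fun x hx => (hbd x hx).1) (fun x hx => (hbd x hx).2) (fun x hx => hH x (hsub hx))
    (hvH.mono_set hsub) hy
  obtain ⟨a, ha, hya, hPa⟩ := exists_flux_lt (H := fun x => H (-x)) (P := fun x => -P (-x))
    (δ := τ / 4) hx₀L hc (by linarith)
    (fun x hx => (hbd x hx).1) (fun x hx => (hbd x hx).2) (fun x hx => by
      have hx' : -x ∈ Ioo (-L) L := ⟨by linarith [(hsub hx).2], by linarith [(hsub hx).1]⟩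
      convert! (hH (-x) hx').comp x (hasDerivAt_neg x) using 1
      rw [hv.even]; ring)
    (by
      have h1 := integrableOn_comp_neg_Ioo hvH
      simp only [hv.even] at h1
      exact h1.mono_set hsub) hy
  have f1 := (hyF ⟨hyb, hb.2⟩).1
  have f2 := (hyF ⟨hya, ha.2⟩).2
  have f3 := hpart (-a) b (by linarith [ha.2]) (by linarith [ha.1, hb.1]) hb.2
  linarith

end IsQuadraticProfile

end

/-! ### First variation of the energy. -/

section

open Set Filter Topology
open scoped NNReal

theorem deriv_nonneg_of_eventually_ge {F : ℝ → ℝ} {F' : ℝ} (hF : HasDerivAt F F' 0)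
    (h : ∀ᶠ ε in 𝓝[>] (0 : ℝ), F 0 ≤ F ε) : 0 ≤ F' := by
  have h1 := hasDerivAt_iff_tendsto_slope_zero.1 hF
  have h2 : Tendsto (fun t => t⁻¹ • (F (0 + t) - F 0)) (𝓝[>] 0) (𝓝 F') :=
    h1.mono_left (nhdsWithin_mono _ fun x hx => ne_of_gt hx)
  refine ge_of_tendsto h2 ?_
  filter_upwards [h, self_mem_nhdsWithin] with ε h3 h4
  have h4' : (0 : ℝ) < ε := h4
  rw [zero_add, smul_eq_mul]
  exact mul_nonneg (inv_pos.2 h4').le (sub_nonneg.2 h3)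

theorem continuous_of_absolutelyContinuousOnInterval {f : ℝ → ℝ}
    (h : ∀ a b, AbsolutelyContinuousOnInterval f a b) : Continuous f := by
  rw [continuous_iff_continuousAt]
  intro x
  have := (h (x - 1) (x + 1)).continuousOn
  rw [uIcc_of_le (by linarith)] at this
  exact this.continuousAt (Icc_mem_nhds (by linarith) (by linarith))

theorem ae_differentiableAt_of_absolutelyContinuousOnInterval {f : ℝ → ℝ}
    (h : ∀ a b, AbsolutelyContinuousOnInterval f a b) : ∀ᵐ x, DifferentiableAt ℝ f x := by
  have h1 : ∀ᵐ x, ∀ n : ℕ, x ∈ uIcc (-(n : ℝ)) n → DifferentiableAt ℝ f x :=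
    ae_all_iff.2 fun n => (h _ _).ae_differentiableAt
  filter_upwards [h1] with x hx
  obtain ⟨n, hn⟩ := exists_nat_ge |x|
  refine hx n ?_
  rw [uIcc_of_le (by linarith [n.cast_nonneg (α := ℝ)])]
  exact abs_le.1 hn

/-- The tangent-line bound for a convex power, from Bernoulli's inequality after scaling by `a`. It
bounds the perturbed mass from below without differentiating under the integral sign. -/
theorem rpow_add_ge {r a t : ℝ} (hr : 1 < r) (ha : 0 ≤ a) (hat : 0 ≤ a + t) :
    a ^ r + r * (a ^ (r - 1) * t) ≤ (a + t) ^ r := by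
  rcases ha.eq_or_lt with rfl | ha
  · rw [Real.zero_rpow (by linarith), Real.zero_rpow (by linarith)]
    simpa using Real.rpow_nonneg hat r
  · have h1 : -1 ≤ t / a := by
      rw [le_div_iff₀ ha]; linarith
    have h2 := one_add_mul_self_le_rpow_one_add h1 hr.le
    have h3 : a + t = a * (1 + t / a) := by field_simp
    have h4 : a ^ (r - 1) * a = a ^ r := by
      rw [← Real.rpow_add_one ha.ne']; simp
    rw [h3, Real.mul_rpow ha.le (by linarith)]
    calc a ^ r + r * (a ^ (r - 1) * t) = a ^ r * (1 + r * (t / a)) := by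
          rw [← h4]; field_simp
      _ ≤ _ := by gcongr

theorem deriv_eq_zero_of_notMem_tsupport {η : ℝ → ℝ} {x : ℝ} (hx : x ∉ tsupport η) :
    deriv η x = 0 := by
  rw [(notMem_tsupport_iff_eventuallyEq.1 hx).deriv_eq]
  simp

theorem memLp_deriv_of_lipschitz {K : ℝ≥0} {η : ℝ → ℝ} (hη : LipschitzWith K η)
    (hc : HasCompactSupport η) : MemLp (deriv η) 2 volume := by
  have h1 : MemLp (fun x => (tsupport η).indicator (fun _ => (K : ℝ)) x) 2 volume :=
    memLp_indicator_const 2 (isClosed_tsupport η).measurableSet _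
      (Or.inr (hc : IsCompact (tsupport η)).measure_lt_top.ne)
  refine h1.mono (measurable_deriv η).aestronglyMeasurable (ae_of_all _ fun x => ?_)
  by_cases hx : x ∈ tsupport η
  · rw [indicator_of_mem hx]
    simpa using norm_deriv_le_of_lipschitz hη (x₀ := x)
  · rw [deriv_eq_zero_of_notMem_tsupport hx, indicator_of_notMem hx]

theorem kineticEnergy_eq (u : ℝ → ℝ) :
    kineticEnergy u = 1 / 4 * ∫ x, deriv (fun y => u y ^ 2) x ^ 2 := by
  rw [kineticEnergy, ← integral_const_mul]
  congr 1
  funext x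
  ring

namespace IsBellShapedMinimizer

variable {p ω : ℝ} {Φ : ℝ → ℝ}

theorem continuous_sq (h : IsBellShapedMinimizer p ω Φ) : Continuous fun x => Φ x ^ 2 :=
  continuous_of_absolutelyContinuousOnInterval h.admissible.absCont

theorem sqrt_sq (h : IsBellShapedMinimizer p ω Φ) (x : ℝ) : √(Φ x ^ 2) = Φ x :=
  Real.sqrt_sq (h.bellShaped.nonneg x)

theorem continuous (h : IsBellShapedMinimizer p ω Φ) : Continuous Φ := by
  have := h.continuous_sq.sqrt
  simpa only [h.sqrt_sq] using this

theorem abs_rpow_eq (h : IsBellShapedMinimizer p ω Φ) (x : ℝ) :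
    |Φ x| ^ p = (Φ x ^ 2) ^ (p / 2) := by
  have h0 := h.bellShaped.nonneg x
  rw [abs_of_nonneg h0, ← Real.rpow_natCast (Φ x) 2, ← Real.rpow_mul h0]
  congr 1
  push_cast
  ring

theorem integral_rpow (h : IsBellShapedMinimizer p ω Φ) : ∫ x, (Φ x ^ 2) ^ (p / 2) = 1 := by
  simp_rw [← h.abs_rpow_eq]
  exact h.admissible.norm_one

theorem integrable_rpow (h : IsBellShapedMinimizer p ω Φ) :
    Integrable fun x => (Φ x ^ 2) ^ (p / 2) := by
  by_contra hn
  have := h.integral_rpow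
  rw [integral_undef hn] at this
  norm_num at this

theorem integrable_sq (h : IsBellShapedMinimizer p ω Φ) : Integrable fun x => Φ x ^ 2 :=
  h.admissible.memLp.integrable_sq

/-- Minimality, in homogeneous form. -/
theorem energy_le_of_mass_ge (h : IsBellShapedMinimizer p ω Φ) (hp : 2 < p) (hω : 0 < ω)
    {w : ℝ → ℝ} {m₀ : ℝ} (hw0 : ∀ x, 0 ≤ w x) (hwi : Integrable w)
    (hac : ∀ a b, AbsolutelyContinuousOnInterval w a b) (hd : MemLp (deriv w) 2 volume)
    (hm₀ : 0 < m₀) (hm : m₀ ≤ ∫ x, w x ^ (p / 2)) :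
    energyN ω Φ ≤ 1 / 4 * (m₀ ^ (-(2 / p))) ^ 2 * (∫ x, deriv w x ^ 2)
      + ω * (m₀ ^ (-(2 / p)) * ∫ x, w x) := by
  set m := ∫ x, w x ^ (p / 2) with hmdef
  have hmpos : 0 < m := hm₀.trans_le hm
  -- The factor for which `√(s w)` satisfies the constraint: `s ^ (p/2) * m = 1`. It decreases in
  -- `m`, so a lower bound on the mass is enough for an upper bound on the energy.
  set s := m ^ (-(2 / p)) with hs
  have hspos : 0 < s := Real.rpow_pos_of_pos hmpos _
  have hss : s ≤ m₀ ^ (-(2 / p)) := by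
    refine Real.rpow_le_rpow_of_nonpos hm₀ hm ?_
    have : 0 < 2 / p := by positivity
    linarith
  have husq : (fun x => √(s * w x) ^ 2) = fun x => s * w x :=
    funext fun x => Real.sq_sqrt (mul_nonneg hspos.le (hw0 x))
  have hderiv : deriv (fun x => s * w x) = fun x => s * deriv w x :=
    funext fun x => deriv_const_mul_field s
  have hwc := continuous_of_absolutelyContinuousOnInterval hac
  have hadm : IsAdmissible p (fun x => √(s * w x)) := by
    refine ⟨?_, ?_, ?_, ?_⟩
    · have hcont : Continuous fun x => √(s * w x) := (continuous_const.mul hwc).sqrt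
      rw [memLp_two_iff_integrable_sq hcont.aestronglyMeasurable, husq]
      exact hwi.const_mul s
    · rw [husq]
      exact fun a b => (hac a b).const_mul s
    · rw [husq, hderiv]
      exact hd.const_mul s
    · have e : ∀ x, |√(s * w x)| ^ p = s ^ (p / 2) * w x ^ (p / 2) := by
        intro x
        rw [abs_of_nonneg (Real.sqrt_nonneg _), Real.sqrt_eq_rpow,
          ← Real.rpow_mul (mul_nonneg hspos.le (hw0 x)), ← Real.mul_rpow hspos.le (hw0 x)]
        congr 1
        ring
      simp_rw [e]
      rw [integral_const_mul, ← hmdef, hs, ← Real.rpow_mul hmpos.le]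
      have : -(2 / p) * (p / 2) = -1 := by
        have : p ≠ 0 := by linarith
        field_simp
      rw [this, Real.rpow_neg_one, inv_mul_cancel₀ hmpos.ne']
  have hmin := h.minimal _ hadm
  have e1 : energyN ω (fun x => √(s * w x))
      = 1 / 4 * s ^ 2 * (∫ x, deriv w x ^ 2) + ω * (s * ∫ x, w x) := by
    rw [energyN, kineticEnergy_eq, husq, hderiv]
    simp_rw [mul_pow]
    rw [integral_const_mul, integral_const_mul]
    ring
  rw [e1] at hmin
  have i1 : 0 ≤ ∫ x, deriv w x ^ 2 := integral_nonneg fun x => sq_nonneg _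
  have i2 : 0 ≤ ∫ x, w x := integral_nonneg hw0
  refine hmin.trans ?_
  gcongr

/-- The one-sided Euler–Lagrange inequality. -/
theorem variation_nonneg (h : IsBellShapedMinimizer p ω Φ) (hp : 2 < p) (hω : 0 < ω)
    {K : ℝ≥0} {η : ℝ → ℝ} (hη : LipschitzWith K η) (hc : HasCompactSupport η)
    (hadm : ∀ᶠ ε in 𝓝[>] (0 : ℝ), ∀ x, 0 ≤ Φ x ^ 2 + ε * η x) :
    0 ≤ 1 / 2 * (∫ x, deriv (fun y => Φ y ^ 2) x * deriv η x) + ω * (∫ x, η x)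
      - lagrangeMultiplier ω Φ * ∫ x, (Φ x ^ 2) ^ (p / 2 - 1) * η x := by
  set v : ℝ → ℝ := fun x => Φ x ^ 2 with hv
  have hvc : Continuous v := h.continuous_sq
  have hηc := hη.continuous
  have hv' : MemLp (deriv v) 2 volume := h.admissible.memLp_deriv
  have hη' := memLp_deriv_of_lipschitz hη hc
  have hpow : Continuous fun x => v x ^ (p / 2 - 1) :=
    hvc.rpow_const fun x => Or.inr (by linarith)
  have ia : Integrable fun x => v x ^ (p / 2 - 1) * η x :=
    (hpow.mul hηc).integrable_of_hasCompactSupport hc.mul_left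
  have iη : Integrable η := hηc.integrable_of_hasCompactSupport hc
  set a := ∫ x, v x ^ (p / 2 - 1) * η x with ha
  set b := ∫ x, deriv v x * deriv η x with hb
  set b₂ := ∫ x, deriv η x ^ 2
  set n := ∫ x, η x
  set B := ∫ x, deriv v x ^ 2
  set M := ∫ x, v x
  have hacη : ∀ x y, AbsolutelyContinuousOnInterval η x y := fun x y =>
    (hη.lipschitzOnWith (s := uIcc x y)).absolutelyContinuousOnInterval
  have hm0 : Tendsto (fun ε : ℝ => 1 + p / 2 * (ε * a)) (𝓝[>] 0) (𝓝 1) := by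
    have : Continuous fun ε : ℝ => 1 + p / 2 * (ε * a) := by fun_prop
    have := this.tendsto 0
    simp only [zero_mul, mul_zero, add_zero] at this
    exact this.mono_left nhdsWithin_le_nhds
  -- An explicit upper bound for the energy of the normalized perturbation of `Φ²` by `ε η`, with
  -- the mass replaced by its tangent line at `ε = 0`. Equality holds at `ε = 0`, so the right
  -- derivative there is nonnegative.
  let F : ℝ → ℝ := fun ε =>
    1 / 4 * ((1 + p / 2 * (ε * a)) ^ (-(2 / p))) ^ 2 * (B + ε * (2 * b) + ε ^ 2 * b₂)
      + ω * ((1 + p / 2 * (ε * a)) ^ (-(2 / p)) * (M + ε * n))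
  have hF0 : F 0 = energyN ω Φ := by
    simp only [F, energyN, kineticEnergy_eq]
    simp [B, M, hv]
  have hev : ∀ᶠ ε in 𝓝[>] (0 : ℝ), F 0 ≤ F ε := by
    filter_upwards [hadm, hm0.eventually (lt_mem_nhds one_pos)] with ε hε hmε
    have hdae : ∀ᵐ x, deriv (fun x => v x + ε * η x) x = deriv v x + ε * deriv η x := by
      filter_upwards [ae_differentiableAt_of_absolutelyContinuousOnInterval
        h.admissible.absCont, ae_differentiableAt_of_absolutelyContinuousOnInterval hacη]
        with x hx1 hx2
      exact (hx1.hasDerivAt.add (hx2.hasDerivAt.const_mul ε)).deriv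
    have hwr : Integrable fun x => (v x + ε * η x) ^ (p / 2) := by
      have hcont : Continuous fun x => (v x + ε * η x) ^ (p / 2) :=
        (hvc.add (continuous_const.mul hηc)).rpow_const fun x => Or.inr (by linarith)
      have hcont' : Continuous fun x => v x ^ (p / 2) :=
        hvc.rpow_const fun x => Or.inr (by linarith)
      have hcs : HasCompactSupport fun x => (v x + ε * η x) ^ (p / 2) - v x ^ (p / 2) := by
        refine hc.mono fun x hx => ?_
        contrapose! hx
        simp only [Function.mem_support, not_not] at hx ⊢
        simp [hx]
      have := h.integrable_rpow.add
        ((hcont.sub hcont').integrable_of_hasCompactSupport hcs)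
      refine this.congr (ae_of_all _ fun x => ?_)
      simp [hv]
    have key := h.energy_le_of_mass_ge hp hω (w := fun x => v x + ε * η x) hε
      (h.integrable_sq.add (iη.const_mul ε))
      (fun x y => (h.admissible.absCont x y).fun_add ((hacη x y).const_mul ε))
      ((memLp_congr_ae hdae).2 (hv'.add (hη'.const_mul ε))) hmε (by
        have h1 : ∀ x, v x ^ (p / 2) + p / 2 * (ε * (v x ^ (p / 2 - 1) * η x))
            ≤ (v x + ε * η x) ^ (p / 2) := by
          intro x
          have := rpow_add_ge (r := p / 2) (by linarith) (sq_nonneg (Φ x)) (hε x)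
          calc _ = v x ^ (p / 2) + p / 2 * (v x ^ (p / 2 - 1) * (ε * η x)) := by ring
            _ ≤ _ := this
        have h2 := integral_mono (h.integrable_rpow.add ((ia.const_mul ε).const_mul (p / 2)))
          hwr h1
        simp only [Pi.add_apply] at h2
        rw [integral_add h.integrable_rpow ((ia.const_mul ε).const_mul (p / 2)),
          integral_const_mul, integral_const_mul, h.integral_rpow] at h2
        exact h2)
    rw [hF0]
    refine key.trans_eq ?_
    have e1 : ∫ x, deriv (fun x => v x + ε * η x) x ^ 2 = B + ε * (2 * b) + ε ^ 2 * b₂ := by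
      have e : ∫ x, deriv (fun x => v x + ε * η x) x ^ 2
          = ∫ x, (deriv v x ^ 2 + ε * (2 * (deriv v x * deriv η x))) + ε ^ 2 * deriv η x ^ 2 := by
        refine integral_congr_ae ?_
        filter_upwards [hdae] with x hx
        rw [hx]; ring
      have j1 := hv'.integrable_sq
      have j2 : Integrable fun x => deriv v x * deriv η x := hv'.integrable_mul hη'
      have j3 := hη'.integrable_sq
      rw [e, integral_add (f := fun x => deriv v x ^ 2 + ε * (2 * (deriv v x * deriv η x)))
        (j1.add ((j2.const_mul 2).const_mul ε)) (j3.const_mul _),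
        integral_add j1 ((j2.const_mul 2).const_mul ε), integral_const_mul, integral_const_mul,
        integral_const_mul]
    have e2 : ∫ x, v x + ε * η x = M + ε * n := by
      rw [integral_add h.integrable_sq (iη.const_mul ε), integral_const_mul]
    rw [e1, e2]
  have hd0 : HasDerivAt (fun ε : ℝ => (1 + p / 2 * (ε * a)) ^ (-(2 / p))) (-a) 0 := by
    have h1 : HasDerivAt (fun ε : ℝ => 1 + p / 2 * (ε * a)) (p / 2 * (1 * a)) 0 :=
      (((hasDerivAt_id (0 : ℝ)).mul_const a).const_mul (p / 2)).const_add 1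
    convert! h1.rpow_const (p := -(2 / p)) (Or.inl (by simp)) using 1
    have : p ≠ 0 := by linarith
    simp
    field_simp
  have hFd : HasDerivAt F (1 / 4 * (2 * (-a) * B + 2 * b) + ω * (-a * M + n)) 0 := by
    have h2 : HasDerivAt (fun ε : ℝ => B + ε * (2 * b) + ε ^ 2 * b₂) (2 * b) 0 := by
      convert! (((hasDerivAt_id (0 : ℝ)).mul_const (2 * b)).const_add B).add
        ((hasDerivAt_pow 2 (0 : ℝ)).mul_const b₂) using 1
      simp
    have h3 : HasDerivAt (fun ε : ℝ => M + ε * n) n 0 := by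
      convert! ((hasDerivAt_id (0 : ℝ)).mul_const n).const_add M using 1
      simp
    convert! (((hd0.fun_pow 2).const_mul (1 / 4)).mul h2).add ((hd0.mul h3).const_mul ω) using 1
    simp
    ring
  have hfin := deriv_nonneg_of_eventually_ge hFd hev
  -- The normalization factor contributes `-a` times exactly this quantity to `F'(0)`, which is how
  -- the multiplier arises.
  have hlm : lagrangeMultiplier ω Φ = 1 / 2 * B + ω * M := by
    rw [lagrangeMultiplier, kineticEnergy_eq]
    ring
  rw [hlm]
  linarith

end IsBellShapedMinimizer

end

/-! ### Euler–Lagrange equation, compact support and edge behaviour of the minimizer. -/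

section

open Set Filter Topology
open scoped NNReal

namespace IsBellShapedMinimizer

variable {p ω : ℝ} {Φ : ℝ → ℝ}

theorem lagrangeMultiplier_nonneg (hω : 0 < ω) : 0 ≤ lagrangeMultiplier ω Φ := by
  have h1 : 0 ≤ kineticEnergy Φ := integral_nonneg fun x => sq_nonneg _
  have h2 : 0 ≤ ∫ x, Φ x ^ 2 := integral_nonneg fun x => sq_nonneg _
  rw [lagrangeMultiplier]
  positivity

/-- The Euler–Lagrange equation in weak form on an interval where `Φ` does not vanish. -/
theorem integral_deriv_mul_deriv_test (h : IsBellShapedMinimizer p ω Φ) (hp : 2 < p)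
    (hω : 0 < ω) {a b : ℝ} (hpos : ∀ x ∈ Ioo a b, 0 < Φ x ^ 2) {η : ℝ → ℝ}
    (hη : IsRealTest a b η) :
    1 / 2 * (∫ x, deriv (fun y => Φ y ^ 2) x * deriv η x) + ω * (∫ x, η x)
      - lagrangeMultiplier ω Φ * ∫ x, (Φ x ^ 2) ^ (p / 2 - 1) * η x = 0 := by
  -- `Φ²` has a positive minimum on the compact support of `ξ`, so small perturbations of either
  -- sign keep it nonnegative. Using both `η` and `-η` turns the inequality into an equation.
  have side : ∀ {ξ : ℝ → ℝ}, IsRealTest a b ξ →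
      ∀ᶠ ε in 𝓝[>] (0 : ℝ), ∀ x, 0 ≤ Φ x ^ 2 + ε * ξ x := by
    intro ξ hξ
    have hK : IsCompact (tsupport ξ) := hξ.compact
    obtain hE | hE := (tsupport ξ).eq_empty_or_nonempty
    · refine Eventually.of_forall fun ε x => ?_
      rw [image_eq_zero_of_notMem_tsupport (f := ξ) (x := x) (by simp [hE])]
      simpa using sq_nonneg (Φ x)
    obtain ⟨x₀, hx₀, hmin⟩ := hK.exists_isMinOn hE h.continuous_sq.continuousOn
    obtain ⟨N, hN⟩ := hK.exists_bound_of_continuousOn hξ.continuous.continuousOn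
    have hμ := hpos x₀ (hξ.subset hx₀)
    have hN0 : 0 ≤ N := (norm_nonneg _).trans (hN x₀ hx₀)
    have hlim : Tendsto (fun ε : ℝ => ε * N) (𝓝[>] 0) (𝓝 0) := by
      have : Continuous fun ε : ℝ => ε * N := by fun_prop
      have := this.tendsto 0
      rw [zero_mul] at this
      exact this.mono_left nhdsWithin_le_nhds
    filter_upwards [hlim.eventually (gt_mem_nhds hμ), self_mem_nhdsWithin] with ε hε hε0 x
    have hε0' : (0 : ℝ) < ε := hε0
    by_cases hx : x ∈ tsupport ξ
    · have h1 := (abs_le.1 (hN x hx)).1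
      have h2 : Φ x₀ ^ 2 ≤ Φ x ^ 2 := hmin hx
      nlinarith
    · rw [image_eq_zero_of_notMem_tsupport hx]
      simpa using sq_nonneg (Φ x)
  have main : ∀ {ξ : ℝ → ℝ}, IsRealTest a b ξ →
      0 ≤ 1 / 2 * (∫ x, deriv (fun y => Φ y ^ 2) x * deriv ξ x) + ω * (∫ x, ξ x)
        - lagrangeMultiplier ω Φ * ∫ x, (Φ x ^ 2) ^ (p / 2 - 1) * ξ x := by
    intro ξ hξ
    obtain ⟨K, hK⟩ := ContDiff.lipschitzWith_of_hasCompactSupport hξ.compact hξ.smooth (by simp)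
    exact h.variation_nonneg hp hω hK hξ.compact (side hξ)
  have h1 := main hη
  have h2 := main (hη.const_mul (-1))
  simp only [neg_mul, one_mul, deriv.fun_neg, mul_neg, integral_neg] at h2
  linarith

/-- The Euler–Lagrange equation `½ (Φ²)'' = ω - c Φ^(p-2)` where `Φ` does not vanish. -/
theorem exists_hasDerivAt (h : IsBellShapedMinimizer p ω Φ) (hp : 2 < p)
    (hω : 0 < ω) {a b : ℝ} (hab : a < b) (hpos : ∀ x ∈ Ioo a b, 0 < Φ x ^ 2) :
    ∃ V : ℝ → ℝ, (∀ x ∈ Ioo a b, HasDerivAt (fun y => Φ y ^ 2) (V x) x) ∧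
      ∀ x, HasDerivAt V
        (2 * ω - 2 * lagrangeMultiplier ω Φ * (Φ x ^ 2) ^ (p / 2 - 1)) x := by
  set v : ℝ → ℝ := fun y => Φ y ^ 2 with hv
  set c := lagrangeMultiplier ω Φ
  set q : ℝ → ℝ := fun x => 2 * ω - 2 * c * v x ^ (p / 2 - 1) with hq
  have hpowc : Continuous fun x => v x ^ (p / 2 - 1) :=
    h.continuous_sq.rpow_const fun x => Or.inr (by linarith)
  have hqc : Continuous q := continuous_const.sub (continuous_const.mul hpowc)
  have hQ : ∀ x, HasDerivAt (fun x => ∫ t in (0 : ℝ)..x, q t) (q x) x := fun x =>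
    intervalIntegral.integral_hasDerivAt_right (hqc.intervalIntegrable _ _)
      (hqc.stronglyMeasurableAtFilter _ _) hqc.continuousAt
  set Q : ℝ → ℝ := fun x => ∫ t in (0 : ℝ)..x, q t
  have hQc : Continuous Q := continuous_iff_continuousAt.2 fun x => (hQ x).continuousAt
  have hv'loc : LocallyIntegrableOn (deriv v) (Ioo a b) :=
    (h.admissible.memLp_deriv.locallyIntegrable (by norm_num)).locallyIntegrableOn _
  have hQloc : LocallyIntegrableOn Q (Ioo a b) :=
    hQc.continuousOn.locallyIntegrableOn measurableSet_Ioo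
  obtain ⟨k, hk⟩ := ae_eq_const_of_integral_mul_deriv_eq_zero hab (hv'loc.sub hQloc) (by
    intro η hη
    have h1 := h.integral_deriv_mul_deriv_test hp hω hpos hη
    have h2 := hη.integral_mul_deriv (fun x _ => hQ x) hqc.continuousOn
    have i1 : Integrable fun x => v x ^ (p / 2 - 1) * η x :=
      hη.integrable_mul (hpowc.continuousOn.locallyIntegrableOn measurableSet_Ioo)
    have h3 : ∫ x, q x * η x = 2 * ω * (∫ x, η x) - 2 * c * ∫ x, v x ^ (p / 2 - 1) * η x := by
      rw [← integral_const_mul, ← integral_const_mul,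
        ← integral_sub (hη.integrable.const_mul _) (i1.const_mul _)]
      congr 1
      funext x
      simp only [hq]
      ring
    simp only [Pi.sub_apply, sub_mul]
    rw [integral_sub (hη.deriv.integrable_mul hv'loc) (hη.deriv.integrable_mul hQloc), h2, h3]
    linarith)
  have hVc : Continuous fun x => Q x + k := hQc.add continuous_const
  -- `V` is a primitive on the whole line of a continuous function; only its identification with
  -- `(Φ²)'` is confined to `(a, b)`.
  refine ⟨fun x => Q x + k, fun x hx => ?_, fun x => (hQ x).add_const k⟩
  have hint : ∀ y ∈ Ioo a b, v y = v x + ∫ t in x..y, (Q t + k) := by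
    intro y hy
    have h1 := (h.admissible.absCont x y).integral_deriv_eq_sub
    have h2 : ∫ t in x..y, deriv v t = ∫ t in x..y, (Q t + k) := by
      refine intervalIntegral.integral_congr_ae ?_
      filter_upwards [hk] with t ht htxy
      have hmem : t ∈ Ioo a b := by
        have := uIoc_subset_uIcc htxy
        rw [mem_uIcc] at this
        rcases this with h' | h'
        · exact ⟨hx.1.trans_le h'.1, h'.2.trans_lt hy.2⟩
        · exact ⟨hy.1.trans_le h'.1, h'.2.trans_lt hx.2⟩
      have := ht hmem
      simp only [Pi.sub_apply] at this
      linarith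
    linarith
  have hd : HasDerivAt (fun y => v x + ∫ t in x..y, (Q t + k)) (Q x + k) x :=
    (intervalIntegral.integral_hasDerivAt_right (hVc.intervalIntegrable _ _)
      (hVc.stronglyMeasurableAtFilter _ _) hVc.continuousAt).const_add _
  refine hd.congr_of_eventuallyEq ?_
  filter_upwards [isOpen_Ioo.mem_nhds hx] with y hy
  exact hint y hy

/-- Bootstrap on the first-order system for `Φ²` and its derivative `V`: real powers are smooth away
from zero, so each round gains one derivative for both. -/
theorem contDiffOn_sq (h : IsBellShapedMinimizer p ω Φ) (hp : 2 < p)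
    (hω : 0 < ω) {a b : ℝ} (hab : a < b) (hpos : ∀ x ∈ Ioo a b, 0 < Φ x ^ 2) :
    ContDiffOn ℝ ((⊤ : ℕ∞) : WithTop ℕ∞) (fun y => Φ y ^ 2) (Ioo a b) := by
  obtain ⟨V, hV, hV'⟩ := h.exists_hasDerivAt hp hω hab hpos
  rw [contDiffOn_infty]
  intro n
  suffices ContDiffOn ℝ n (fun y => Φ y ^ 2) (Ioo a b) ∧ ContDiffOn ℝ n V (Ioo a b) from this.1
  induction n with
  | zero =>
    refine ⟨contDiffOn_zero.2 h.continuous_sq.continuousOn, contDiffOn_zero.2 ?_⟩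
    exact fun x _ => (hV' x).continuousAt.continuousWithinAt
  | succ n ih =>
    rw [Nat.cast_succ, contDiffOn_succ_iff_deriv_of_isOpen isOpen_Ioo,
      contDiffOn_succ_iff_deriv_of_isOpen isOpen_Ioo]
    refine ⟨⟨fun x hx => (hV x hx).differentiableAt.differentiableWithinAt,
      by simp, ih.2.congr fun x hx => (hV x hx).deriv⟩,
      fun x hx => (hV' x).differentiableAt.differentiableWithinAt, by simp, ?_⟩
    refine ContDiffOn.congr ?_ fun x hx => (hV' x).deriv
    exact contDiffOn_const.sub (contDiffOn_const.mul
      (ih.1.rpow_const_of_ne fun x hx => (hpos x hx).ne'))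

theorem antitoneOn_sq (h : IsBellShapedMinimizer p ω Φ) :
    AntitoneOn (fun x => Φ x ^ 2) (Ioi 0) := fun x hx y hy hxy => by
  have h1 := h.bellShaped.antitoneOn hx hy hxy
  have h2 := h.bellShaped.nonneg y
  simp only
  gcongr

/-- Where `Φ` is small, `Φ²` is uniformly convex, hence at least quadratic. -/
theorem quadratic_le_sq (h : IsBellShapedMinimizer p ω Φ) (hp : 2 < p)
    (hω : 0 < ω) {a b : ℝ} (ha : 0 ≤ a) (hab : a < b) (hpos : ∀ x ∈ Ioo a b, 0 < Φ x ^ 2)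
    (hsmall : ∀ x ∈ Ioo a b, 2 * lagrangeMultiplier ω Φ * (Φ x ^ 2) ^ (p / 2 - 1) ≤ ω)
    {x : ℝ} (hx : x ∈ Ioo a b) : ω / 2 * (b - x) ^ 2 ≤ Φ x ^ 2 := by
  obtain ⟨V, hV, hV'⟩ := h.exists_hasDerivAt hp hω hab hpos
  have hVnonpos : ∀ y ∈ Ioo a b, V y ≤ 0 := by
    intro y hy
    have hd : HasDerivAt (fun ε : ℝ => -(Φ (y + ε) ^ 2)) (-V y) 0 :=
      (HasDerivAt.comp_const_add y 0 (by simpa using hV y hy)).neg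
    have := deriv_nonneg_of_eventually_ge hd (by
      filter_upwards [self_mem_nhdsWithin] with ε hε
      have hε' : (0 : ℝ) < ε := hε
      have hy0 : 0 < y := ha.trans_lt hy.1
      have := h.antitoneOn_sq (mem_Ioi.2 hy0) (mem_Ioi.2 (by linarith : 0 < y + ε))
        (by linarith)
      simp only [add_zero] at this ⊢
      linarith)
    linarith
  have hstep : ∀ y ∈ Ioo a b, ∀ z ∈ Ioo a b, y ≤ z → ω * (z - y) ≤ V z - V y := by
    intro y hy z hz hyz
    refine (convex_Ioo a b).mul_sub_le_image_sub_of_le_deriv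
      (fun t _ => (hV' t).continuousAt.continuousWithinAt)
      (fun t _ => (hV' t).differentiableAt.differentiableWithinAt) (fun t ht => ?_) y hy z hz hyz
    rw [interior_Ioo] at ht
    rw [(hV' t).deriv]
    linarith [hsmall t ht]
  -- `V' ≥ ω` by smallness and `V ≤ 0` by monotonicity, so letting `z` tend to `b` bounds `V y`.
  -- Integrating back from `b` then uses only `Φ(b)² ≥ 0`; the endpoint need not be a zero.
  have hVle : ∀ y ∈ Ioo a b, V y ≤ -(ω * (b - y)) := by
    intro y hy
    have hlim : Tendsto (fun z => -(ω * (z - y))) (𝓝[<] b) (𝓝 (-(ω * (b - y)))) := by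
      have : Continuous fun z : ℝ => -(ω * (z - y)) := by fun_prop
      exact this.continuousWithinAt.tendsto
    refine ge_of_tendsto hlim ?_
    filter_upwards [Ioo_mem_nhdsLT hy.2] with z hz
    have hz' : z ∈ Ioo a b := ⟨hy.1.trans hz.1, hz.2⟩
    linarith [hstep y hy z hz' hz.1.le, hVnonpos z hz']
  have hd : ∀ y ∈ Ioo a b,
      HasDerivAt (fun y => Φ y ^ 2 - ω / 2 * (b - y) ^ 2) (V y + ω * (b - y)) y := by
    intro y hy
    convert! (hV y hy).sub ((((hasDerivAt_id y).const_sub b).fun_pow 2).const_mul (ω / 2)) using 1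
    simp
    ring
  have hanti : AntitoneOn (fun y => Φ y ^ 2 - ω / 2 * (b - y) ^ 2) (Icc x b) := by
    have hsub : Ioo x b ⊆ Ioo a b := Ioo_subset_Ioo_left hx.1.le
    refine antitoneOn_of_deriv_nonpos (convex_Icc _ _) ?_ ?_ ?_
    · have := h.continuous_sq
      fun_prop
    · rw [interior_Icc]
      exact fun y hy => (hd y (hsub hy)).differentiableAt.differentiableWithinAt
    · rw [interior_Icc]
      intro y hy
      rw [(hd y (hsub hy)).deriv]
      linarith [hVle y (hsub hy)]
  have := hanti (left_mem_Icc.2 hx.2.le) (right_mem_Icc.2 hx.2.le) hx.2.le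
  simp only [sub_self] at this
  nlinarith [sq_nonneg (Φ b)]

theorem exists_small (hp : 2 < p) (hω : 0 < ω) (Φ : ℝ → ℝ) :
    ∃ ε > 0, ∀ t, 0 ≤ t → t < ε → 2 * lagrangeMultiplier ω Φ * t ^ (p / 2 - 1) ≤ ω := by
  have hc : Continuous fun t : ℝ => 2 * lagrangeMultiplier ω Φ * t ^ (p / 2 - 1) :=
    continuous_const.mul (continuous_id.rpow_const fun x => Or.inr (by linarith))
  have h0 := hc.tendsto 0
  rw [Real.zero_rpow (by linarith), mul_zero] at h0
  obtain ⟨ε, hε, hball⟩ := Metric.eventually_nhds_iff.1 (h0.eventually (gt_mem_nhds hω))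
  refine ⟨ε, hε, fun t ht htε => (hball ?_).le⟩
  rwa [Real.dist_eq, sub_zero, abs_of_nonneg ht]

theorem sq_pos_of_lt (h : IsBellShapedMinimizer p ω Φ) {x y : ℝ} (hx : 0 < x) (hxy : x ≤ y)
    (hy : y ∈ Function.support Φ) : 0 < Φ x ^ 2 := by
  have h1 : 0 < Φ y := lt_of_le_of_ne (h.bellShaped.nonneg y) (Ne.symm hy)
  have h2 := h.bellShaped.antitoneOn (mem_Ioi.2 hx) (mem_Ioi.2 (hx.trans_le hxy)) hxy
  exact pow_pos (h1.trans_le h2) 2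

/-- With unbounded support, `Φ²` is positive on the half-line and, being integrable and monotone,
small beyond some `X`. Then `quadratic_le_sq` applies on `(X, X + T)` for every `T`, and the bound
at the fixed point `X + 1` grows without limit. -/
theorem bddAbove_support (h : IsBellShapedMinimizer p ω Φ) (hp : 2 < p) (hω : 0 < ω) :
    BddAbove (Function.support Φ) := by
  by_contra hb
  rw [not_bddAbove_iff] at hb
  have hpos : ∀ x, 0 < x → 0 < Φ x ^ 2 := by
    intro x hx
    obtain ⟨y, hy, hxy⟩ := hb x
    exact h.sq_pos_of_lt hx hxy.le hy
  obtain ⟨ε, hε, hsm⟩ := exists_small hp hω Φ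
  obtain ⟨X, hX, hXε⟩ : ∃ X, 0 < X ∧ Φ X ^ 2 < ε := by
    by_contra! hcon
    have hi : IntegrableOn (fun _ : ℝ => ε) (Ioi 0) := by
      refine h.integrable_sq.integrableOn.mono' aestronglyMeasurable_const ?_
      filter_upwards [ae_restrict_mem measurableSet_Ioi] with x hx
      rw [Real.norm_eq_abs, abs_of_pos hε]
      exact hcon x hx
    rw [integrableOn_const_iff] at hi
    simp [hε.ne'] at hi
  have hT : ∀ T : ℝ, 1 < T → ω / 2 * (T - 1) ^ 2 ≤ Φ (X + 1) ^ 2 := by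
    intro T hT
    have := h.quadratic_le_sq hp hω hX.le (by linarith : X < X + T)
      (fun x hx => hpos x (hX.trans hx.1)) (fun x hx => hsm _ (sq_nonneg _)
        ((h.antitoneOn_sq (mem_Ioi.2 hX) (mem_Ioi.2 (hX.trans hx.1)) hx.1.le).trans_lt hXε))
      (x := X + 1) ⟨by linarith, by linarith⟩
    rwa [show X + T - (X + 1) = T - 1 by ring] at this
  set W := Φ (X + 1) ^ 2
  have hW : 0 ≤ W := sq_nonneg _
  -- For this `T` the lower bound is at least `2 W + ω/2`, which exceeds `W`.
  have := hT (2 * W / ω + 1 + 1) (by have : 0 ≤ 2 * W / ω := by positivity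
                                     linarith)
  have hz : ω * (2 * W / ω) = 2 * W := by field_simp
  have hz' : 0 ≤ 2 * W / ω := by positivity
  nlinarith

theorem halfLength_pos (h : IsBellShapedMinimizer p ω Φ) (hp : 2 < p) (hω : 0 < ω) :
    0 < halfLength Φ := by
  have hb := h.bddAbove_support hp hω
  obtain ⟨y, hy0, hy⟩ : ∃ y, 0 < y ∧ y ∈ Function.support Φ := by
    by_contra! hcon
    have hz : ∀ x, x ≠ 0 → Φ x = 0 := by
      intro x hx
      rcases lt_or_gt_of_ne hx with hx | hx
      · rw [← h.bellShaped.even]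
        exact Function.notMem_support.1 (hcon (-x) (by linarith))
      · exact Function.notMem_support.1 (hcon x hx)
    have h1 := h.admissible.norm_one
    have h2 : ∫ x, |Φ x| ^ p = ∫ _ : ℝ, (0 : ℝ) := by
      refine integral_congr_ae ?_
      filter_upwards [compl_mem_ae_iff.2 (measure_singleton (0 : ℝ))] with x hx
      rw [hz x hx, abs_zero, Real.zero_rpow (by linarith)]
    rw [h2] at h1
    simp at h1
  exact hy0.trans_le (le_csSup hb hy)

theorem sq_pos (h : IsBellShapedMinimizer p ω Φ) (hp : 2 < p) (hω : 0 < ω) {x : ℝ}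
    (hx : x ∈ Ioo (-halfLength Φ) (halfLength Φ)) : 0 < Φ x ^ 2 := by
  have hL := h.halfLength_pos hp hω
  have hne : (Function.support Φ).Nonempty := by
    by_contra hne
    rw [not_nonempty_iff_eq_empty] at hne
    rw [halfLength, hne, Real.sSup_empty] at hL
    exact lt_irrefl _ hL
  have main : ∀ y, 0 < y → y < halfLength Φ → 0 < Φ y ^ 2 := by
    intro y hy hyL
    obtain ⟨z, hz, hyz⟩ := exists_lt_of_lt_csSup hne hyL
    exact h.sq_pos_of_lt hy hyz.le hz
  rcases lt_trichotomy x 0 with hx0 | rfl | hx0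
  · rw [← h.bellShaped.even]
    exact main (-x) (by linarith) (by linarith [hx.1])
  -- Monotonicity is assumed only on the open half-line, so the value at `0` is reached as a limit
  -- from the right.
  · have h1 : 0 < Φ (halfLength Φ / 2) ^ 2 := main _ (by linarith) (by linarith)
    refine h1.trans_le ?_
    refine ge_of_tendsto (h.continuous_sq.continuousWithinAt (s := Ioi 0)).tendsto ?_
    filter_upwards [Ioo_mem_nhdsGT (by linarith : 0 < halfLength Φ / 2)] with y hy
    exact h.antitoneOn_sq (mem_Ioi.2 hy.1) (mem_Ioi.2 (by linarith)) hy.2.le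
  · exact main x hx0 hx.2

theorem eq_zero_of_gt (h : IsBellShapedMinimizer p ω Φ) (hp : 2 < p) (hω : 0 < ω) {x : ℝ}
    (hx : halfLength Φ < x) : Φ x = 0 := by
  by_contra hne
  exact absurd (le_csSup (h.bddAbove_support hp hω) (Function.mem_support.2 hne)) (not_le.2 hx)

theorem eq_zero_halfLength (h : IsBellShapedMinimizer p ω Φ) (hp : 2 < p) (hω : 0 < ω) :
    Φ (halfLength Φ) = 0 := by
  have h1 : Tendsto Φ (𝓝[>] (halfLength Φ)) (𝓝 (Φ (halfLength Φ))) :=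
    h.continuous.continuousWithinAt.tendsto
  refine tendsto_nhds_unique h1 (tendsto_const_nhds.congr' ?_)
  filter_upwards [self_mem_nhdsWithin] with x hx
  exact (h.eq_zero_of_gt hp hω hx).symm

/-- The tent function of height one and half-width `δ` at `z`. -/
noncomputable def tent (z δ x : ℝ) : ℝ := max (1 - |x - z| / δ) 0

/-- `Φ²` vanishes quadratically at the edge of its support. -/
theorem sq_le_quadratic (h : IsBellShapedMinimizer p ω Φ) (hp : 2 < p) (hω : 0 < ω) {δ : ℝ}
    (hδ : 0 < δ) : Φ (halfLength Φ - δ) ^ 2 ≤ 4 * ω * δ ^ 2 := by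
  set z := halfLength Φ
  set η := tent z δ with hη
  have hlip : LipschitzWith (Real.toNNReal δ⁻¹) η := by
    have h1 : LipschitzWith (Real.toNNReal δ⁻¹) fun x => 1 - |x - z| / δ := by
      refine LipschitzWith.of_dist_le_mul fun x y => ?_
      rw [Real.coe_toNNReal _ (inv_pos.2 hδ).le, Real.dist_eq, Real.dist_eq,
        show 1 - |x - z| / δ - (1 - |y - z| / δ) = δ⁻¹ * (|y - z| - |x - z|) by ring,
        abs_mul, abs_of_pos (inv_pos.2 hδ)]
      refine mul_le_mul_of_nonneg_left ?_ (inv_pos.2 hδ).le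
      refine (abs_abs_sub_abs_le_abs_sub (y - z) (x - z)).trans_eq ?_
      rw [abs_sub_comm x y]
      congr 1
      ring
    exact h1.max_const 0
  have hη0 : ∀ x, 0 ≤ η x := fun x => le_max_right _ _
  have hout : ∀ x, x ∉ Icc (z - δ) (z + δ) → η x = 0 := by
    intro x hx
    refine max_eq_right (sub_nonpos.2 ?_)
    rw [one_le_div hδ]
    by_contra! hlt
    rw [abs_lt] at hlt
    exact hx ⟨by linarith, by linarith⟩
  have hη1 : ∀ x, η x ≤ 1 := fun x =>
    max_le (by have : 0 ≤ |x - z| / δ := by positivity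
               linarith) zero_le_one
  have hcs : HasCompactSupport η := HasCompactSupport.intro isCompact_Icc hout
  -- The tent straddles the edge of the support, where only nonnegative perturbations are
  -- admissible; the one-sided inequality is all that is available.
  have key := h.variation_nonneg hp hω hlip hcs (by
    filter_upwards [self_mem_nhdsWithin] with ε hε x
    have hε' : (0 : ℝ) < ε := hε
    exact add_nonneg (sq_nonneg _) (mul_nonneg hε'.le (hη0 x)))
  have e1 : ∫ x, η x ≤ 2 * δ := by
    have i1 : ∫ x, η x = ∫ x in Icc (z - δ) (z + δ), η x :=
      (setIntegral_eq_integral_of_forall_compl_eq_zero hout).symm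
    rw [i1]
    have i2 : ∫ x in Icc (z - δ) (z + δ), η x ≤ ∫ x in Icc (z - δ) (z + δ), (1 : ℝ) :=
      integral_mono (hlip.continuous.integrable_of_hasCompactSupport hcs).integrableOn
        (integrableOn_const (by simp)) hη1
    refine i2.trans_eq ?_
    rw [setIntegral_const, smul_eq_mul, mul_one, measureReal_def, Real.volume_Icc,
      ENNReal.toReal_ofReal (by linarith)]
    ring
  have e2 : 0 ≤ ∫ x, (Φ x ^ 2) ^ (p / 2 - 1) * η x :=
    integral_nonneg fun x => mul_nonneg (Real.rpow_nonneg (sq_nonneg _) _) (hη0 x)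
  -- Right of the edge `Φ²` vanishes, and on the left half of the tent `η' = 1/δ`. Dropping the
  -- nonlinear term, which has a favourable sign, leaves `½ Φ(L - δ)² / δ ≤ ω ∫ η ≤ 2 ω δ`.
  have e3 : ∫ x, deriv (fun y => Φ y ^ 2) x * deriv η x
      = -(Φ (z - δ) ^ 2 / δ) := by
    have i1 : ∫ x, deriv (fun y => Φ y ^ 2) x * deriv η x
        = ∫ x in Ioc (z - δ) z, deriv (fun y => Φ y ^ 2) x * δ⁻¹ := by
      rw [← integral_indicator measurableSet_Ioc]
      refine integral_congr_ae ?_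
      filter_upwards [compl_mem_ae_iff.2 (measure_singleton (z - δ)),
        compl_mem_ae_iff.2 (measure_singleton z)] with x hx1 hx2
      have hx1 : x ≠ z - δ := hx1
      have hx2 : x ≠ z := hx2
      rcases lt_or_gt_of_ne hx1 with hlt | hgt
      · have h0 : deriv η x = 0 := by
          have : η =ᶠ[𝓝 x] fun _ => 0 := by
            filter_upwards [gt_mem_nhds hlt] with y hy
            exact hout y fun hy' => absurd hy'.1 (not_le.2 hy)
          rw [this.deriv_eq]; simp
        rw [h0, mul_zero, indicator_of_notMem fun hx => absurd hx.1 (not_lt.2 hlt.le)]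
      · rcases lt_or_gt_of_ne hx2 with hlt' | hgt'
        · rw [indicator_of_mem (show x ∈ Ioc (z - δ) z from ⟨hgt, hlt'.le⟩)]
          have : η =ᶠ[𝓝 x] fun y => 1 - (z - y) / δ := by
            filter_upwards [gt_mem_nhds hlt', lt_mem_nhds hgt] with y hy1 hy2
            simp only [hη, tent]
            rw [abs_of_neg (by linarith), neg_sub, max_eq_left]
            exact sub_nonneg.2 ((div_le_one hδ).2 (by linarith))
          have hd : HasDerivAt (fun y => 1 - (z - y) / δ) δ⁻¹ x := by
            convert! (((hasDerivAt_id x).const_sub z).div_const δ).const_sub 1 using 1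
            rw [neg_div, neg_neg, one_div]
          rw [this.deriv_eq, hd.deriv]
        · rw [indicator_of_notMem fun hx => absurd hx.2 (not_le.2 hgt')]
          have : (fun y => Φ y ^ 2) =ᶠ[𝓝 x] fun _ => 0 := by
            filter_upwards [lt_mem_nhds hgt'] with y hy
            rw [h.eq_zero_of_gt hp hω hy]; simp
          rw [this.deriv_eq]; simp
    rw [i1, ← intervalIntegral.integral_of_le (by linarith), intervalIntegral.integral_mul_const,
      (h.admissible.absCont (z - δ) z).integral_deriv_eq_sub, h.eq_zero_halfLength hp hω]
    ring
  rw [e3] at key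
  have hc := lagrangeMultiplier_nonneg (Φ := Φ) hω
  have h4 : Φ (z - δ) ^ 2 / δ ≤ 4 * ω * δ := by
    nlinarith [mul_nonneg hc e2]
  rw [div_le_iff₀ hδ] at h4
  linarith

theorem isQuadraticProfile (h : IsBellShapedMinimizer p ω Φ) (hp : 2 < p) (hω : 0 < ω) :
    IsQuadraticProfile (halfLength Φ) (fun x => Φ x ^ 2) where
  length_pos := h.halfLength_pos hp hω
  continuous := h.continuous_sq
  smooth := h.contDiffOn_sq hp hω (by linarith [h.halfLength_pos hp hω])
    fun x hx => h.sq_pos hp hω hx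
  pos x hx := h.sq_pos hp hω hx
  even x := by rw [h.bellShaped.even]
  bounds := by
    have hL := h.halfLength_pos hp hω
    obtain ⟨ε, hε, hsm⟩ := exists_small hp hω Φ
    have hev : ∀ᶠ x in 𝓝[<] (halfLength Φ), Φ x ^ 2 < ε := by
      refine (h.continuous_sq.continuousWithinAt.tendsto).eventually (gt_mem_nhds ?_)
      rw [h.eq_zero_halfLength hp hω]
      simpa using hε
    obtain ⟨y, hy, hyε⟩ := (mem_nhdsLT_iff_exists_Ioo_subset' hL).1 hev
    have hsub : Ioo (max 0 y) (halfLength Φ) ⊆ Ioo y (halfLength Φ) :=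
      Ioo_subset_Ioo_left (le_max_right _ _)
    refine ⟨max 0 y, ω / 2, 4 * ω, le_max_left _ _, max_lt hL hy, by positivity, fun x hx => ?_⟩
    refine ⟨?_, ?_⟩
    · refine h.quadratic_le_sq hp hω (le_max_left 0 y) (max_lt hL hy) (fun t ht => ?_)
        (fun t ht => hsm _ (sq_nonneg _) (hyε (hsub ht))) hx
      exact h.sq_pos hp hω ⟨by linarith [(le_max_left 0 y).trans_lt ht.1], ht.2⟩
    · have := h.sq_le_quadratic hp hω (sub_pos.2 hx.2)
      simpa using this

end IsBellShapedMinimizer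

end

/-! ### Factorization of the operator and self-adjoint extensions. -/

section

open Set Filter Topology

namespace IsBellShapedMinimizer

variable {p ω : ℝ} {Φ : ℝ → ℝ}

theorem pos (h : IsBellShapedMinimizer p ω Φ) (hp : 2 < p) (hω : 0 < ω) {x : ℝ}
    (hx : x ∈ bodyInterval Φ) : 0 < Φ x :=
  lt_of_le_of_ne (h.bellShaped.nonneg x) fun h0 => by
    have := h.sq_pos hp hω hx
    rw [← h0] at this
    simp at this

theorem contDiffOn (h : IsBellShapedMinimizer p ω Φ) (hp : 2 < p) (hω : 0 < ω) :
    ContDiffOn ℝ ((⊤ : ℕ∞) : WithTop ℕ∞) Φ (Ioo (-halfLength Φ) (halfLength Φ)) :=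
  ((h.isQuadraticProfile hp hω).smooth.sqrt fun _ hx => (h.sq_pos hp hω hx).ne').congr
    fun x _ => (h.sqrt_sq x).symm

/-- This lets the substitution `f = Φ φ` be used inside the domain `C₀^∞` of the minimal operator.
-/
theorem isTestFunction_mul (h : IsBellShapedMinimizer p ω Φ) (hp : 2 < p) (hω : 0 < ω)
    {φ : ℝ → ℝ} (hφ : IsRealTest (-halfLength Φ) (halfLength Φ) φ) :
    IsTestFunction (bodyInterval Φ) (fun x => ((Φ x * φ x : ℝ) : ℂ)) := by
  have hψ := hφ.mul_left (h.contDiffOn hp hω)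
  refine ⟨Complex.ofRealCLM.contDiff.comp hψ.smooth, ?_, ?_⟩
  · exact hψ.compact.comp_left (g := fun x : ℝ => (x : ℂ)) Complex.ofReal_zero
  · exact (tsupport_comp_subset (g := fun x : ℝ => (x : ℂ)) Complex.ofReal_zero _).trans
      hψ.subset

/-- The factorization `𝓛₋ (Φ φ) = -Φ⁻¹ (Φ⁴ φ')'`. -/
theorem LMinusExpr_mul (h : IsBellShapedMinimizer p ω Φ) (hp : 2 < p) (hω : 0 < ω)
    {φ : ℝ → ℝ} (hφ : IsRealTest (-halfLength Φ) (halfLength Φ) φ) {x : ℝ}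
    (hx : x ∈ bodyInterval Φ) :
    LMinusExpr p ω Φ (fun x => ((Φ x * φ x : ℝ) : ℂ)) x
      = ((-((Φ x)⁻¹ * deriv (fun y => (Φ y ^ 2) ^ 2 * deriv φ y) x) : ℝ) : ℂ) := by
  have hL := h.halfLength_pos hp hω
  obtain ⟨V, hV, hV'⟩ := h.exists_hasDerivAt hp hω
    (by linarith : -halfLength Φ < halfLength Φ) fun x hx => h.sq_pos hp hω hx
  have hψ := hφ.mul_left (h.isQuadraticProfile hp hω).smooth
  have e1 : (fun y => (Φ y : ℂ) * ((Φ y * φ y : ℝ) : ℂ))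
      = fun y => ((Φ y ^ 2 * φ y : ℝ) : ℂ) := by
    funext y
    push_cast
    ring
  have e2 : deriv (fun y => ((Φ y ^ 2 * φ y : ℝ) : ℂ))
      = fun y => ((deriv (fun y => Φ y ^ 2 * φ y) y : ℝ) : ℂ) :=
    funext fun y => (hψ.hasDerivAt y).ofReal_comp.deriv
  have e3 := (hψ.deriv.hasDerivAt x).ofReal_comp.deriv
  -- The coefficient of `φ` here is `(Φ²)''` as given by the Euler–Lagrange equation; multiplied by
  -- `-Φ`, it cancels the potential term exactly.
  have e4 : deriv (deriv fun y => Φ y ^ 2 * φ y) x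
      = (2 * ω - 2 * lagrangeMultiplier ω Φ * (Φ x ^ 2) ^ (p / 2 - 1)) * φ x
        + 2 * (V x * deriv φ x) + Φ x ^ 2 * deriv (deriv φ) x := by
    have : deriv (fun y => Φ y ^ 2 * φ y) =ᶠ[𝓝 x]
        fun y => V y * φ y + Φ y ^ 2 * deriv φ y := by
      filter_upwards [isOpen_Ioo.mem_nhds hx] with y hy
      exact ((hV y hy).mul (hφ.hasDerivAt y)).deriv
    rw [this.deriv_eq]
    refine (((hV' x).mul (hφ.hasDerivAt x)).add
      ((hV x hx).mul (hφ.deriv.hasDerivAt x))).deriv.trans ?_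
    ring
  have e5 : deriv (fun y => (Φ y ^ 2) ^ 2 * deriv φ y) x
      = 2 * Φ x ^ 2 * V x * deriv φ x + (Φ x ^ 2) ^ 2 * deriv (deriv φ) x := by
    refine (((hV x hx).fun_pow 2).mul (hφ.deriv.hasDerivAt x)).deriv.trans ?_
    simp
  have e6 : (Φ x ^ 2) ^ (p / 2 - 1) = Φ x ^ (p - 2) := by
    rw [← Real.rpow_natCast (Φ x) 2, ← Real.rpow_mul (h.bellShaped.nonneg x)]
    congr 1
    push_cast
    ring
  rw [LMinusExpr, e1, e2, e3, e4, e5, e6]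
  have hne : Φ x ≠ 0 := (h.pos hp hω hx).ne'
  norm_cast
  field_simp
  ring

theorem isRealTest_image (h : IsBellShapedMinimizer p ω Φ) (hp : 2 < p) (hω : 0 < ω)
    {φ : ℝ → ℝ} (hφ : IsRealTest (-halfLength Φ) (halfLength Φ) φ) :
    IsRealTest (-halfLength Φ) (halfLength Φ)
      (fun x => -((Φ x)⁻¹ * deriv (fun y => (Φ y ^ 2) ^ 2 * deriv φ y) x)) := by
  have h1 := (hφ.deriv.mul_left ((h.isQuadraticProfile hp hω).smooth.pow 2)).deriv
  have h2 := (h1.mul_left ((h.contDiffOn hp hω).inv fun x hx => (h.pos hp hω hx).ne')).const_mul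
    (-1)
  simpa using h2

end IsBellShapedMinimizer

theorem IsRealTest.memLp_ofReal {a b : ℝ} {ψ : ℝ → ℝ} (hψ : IsRealTest a b ψ)
    (μ : Measure ℝ) [IsFiniteMeasureOnCompacts μ] : MemLp (fun x => (ψ x : ℂ)) 2 μ :=
  (Complex.continuous_ofReal.comp hψ.continuous).memLp_of_hasCompactSupport
    (hψ.compact.comp_left (g := fun x : ℝ => (x : ℂ)) Complex.ofReal_zero)

theorem re_inner_of_ae_eq_ofReal {μ : Measure ℝ} {f g : Lp ℂ 2 μ} {ψ : ℝ → ℝ}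
    (hg : g =ᵐ[μ] fun x => (ψ x : ℂ)) : (inner ℂ f g).re = ∫ x, (f x).re * ψ x ∂μ := by
  have hi := L2.integrable_inner (𝕜 := ℂ) f g
  rw [L2.inner_def]
  refine (Complex.reCLM.integral_comp_comm hi).symm.trans (integral_congr_ae ?_)
  filter_upwards [hg] with x hx
  simp [hx, mul_comm]

theorem im_inner_of_ae_eq_ofReal {μ : Measure ℝ} {f g : Lp ℂ 2 μ} {ψ : ℝ → ℝ}
    (hg : g =ᵐ[μ] fun x => (ψ x : ℂ)) : (inner ℂ f g).im = -∫ x, (f x).im * ψ x ∂μ := by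
  have hi := L2.integrable_inner (𝕜 := ℂ) f g
  rw [L2.inner_def, ← integral_neg]
  refine (Complex.imCLM.integral_comp_comm hi).symm.trans (integral_congr_ae ?_)
  filter_upwards [hg] with x hx
  simp [hx, mul_comm]

namespace IsSelfAdjointExtension

variable {p ω : ℝ} {Φ : ℝ → ℝ} {A : BaseSpace Φ →ₗ.[ℂ] BaseSpace Φ}

theorem isFormalAdjoint (hA : IsSelfAdjointExtension p ω Φ A) : A.IsFormalAdjoint A := by
  have h1 := LinearPMap.adjoint_isFormalAdjoint hA.selfAdjoint.dense_domain
  rwa [LinearPMap.isSelfAdjoint_def.1 hA.selfAdjoint] at h1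

/-- Every element of the domain solves the equation weakly. -/
theorem inner_test (hA : IsSelfAdjointExtension p ω Φ A) (h : IsBellShapedMinimizer p ω Φ)
    (hp : 2 < p) (hω : 0 < ω) (u : A.domain) {φ : ℝ → ℝ}
    (hφ : IsRealTest (-halfLength Φ) (halfLength Φ) φ) :
    ∃ f g : BaseSpace Φ,
      f =ᵐ[volume.restrict (bodyInterval Φ)] (fun x => ((Φ x * φ x : ℝ) : ℂ)) ∧
      g =ᵐ[volume.restrict (bodyInterval Φ)]
        (fun x => ((-((Φ x)⁻¹ * deriv (fun y => (Φ y ^ 2) ^ 2 * deriv φ y) x) : ℝ) : ℂ)) ∧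
      inner ℂ (A u) f = inner ℂ (u : BaseSpace Φ) g := by
  have m1 := (hφ.mul_left (h.contDiffOn hp hω)).memLp_ofReal
    (volume.restrict (bodyInterval Φ))
  have m2 := (h.isRealTest_image hp hω hφ).memLp_ofReal (volume.restrict (bodyInterval Φ))
  refine ⟨m1.toLp, m2.toLp, m1.coeFn_toLp, m2.coeFn_toLp, ?_⟩
  have hmem : ((m1.toLp, m2.toLp) : BaseSpace Φ × BaseSpace Φ) ∈ A.graph := by
    refine hA.extends_graph ⟨_, h.isTestFunction_mul hp hω hφ, m1.coeFn_toLp, ?_⟩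
    filter_upwards [m2.coeFn_toLp, ae_restrict_mem measurableSet_Ioo] with x hx hxI
    rw [h.LMinusExpr_mul hp hω hφ hxI]
    exact hx
  obtain ⟨y, hy1, hy2⟩ := (LinearPMap.mem_graph_iff A).1 hmem
  simp only at hy1 hy2
  rw [← hy1, ← hy2]
  exact hA.isFormalAdjoint u y

/-- The test functions and their images are real-valued, so the weak equation separates into real
and imaginary parts even though `A` need not commute with conjugation. -/
theorem isWeakPair_re (hA : IsSelfAdjointExtension p ω Φ A) (h : IsBellShapedMinimizer p ω Φ)
    (hp : 2 < p) (hω : 0 < ω) (u : A.domain) :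
    IsWeakPair (halfLength Φ) (fun x => Φ x ^ 2) (fun x => ((u : BaseSpace Φ) x).re)
      (fun x => (A u x).re) where
  memLp_left := (Lp.memLp (u : BaseSpace Φ)).re
  memLp_right := (Lp.memLp (A u)).re
  weak φ hφ := by
    obtain ⟨f, g, hf, hg, hfg⟩ := hA.inner_test h hp hω u hφ
    have := congrArg Complex.re hfg
    rw [re_inner_of_ae_eq_ofReal hf, re_inner_of_ae_eq_ofReal hg] at this
    simp only [h.sqrt_sq]
    refine this.trans ?_
    rw [← integral_neg]
    refine integral_congr_ae (ae_of_all _ fun x => ?_)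
    simp only [div_eq_mul_inv]
    ring

theorem isWeakPair_im (hA : IsSelfAdjointExtension p ω Φ A) (h : IsBellShapedMinimizer p ω Φ)
    (hp : 2 < p) (hω : 0 < ω) (u : A.domain) :
    IsWeakPair (halfLength Φ) (fun x => Φ x ^ 2) (fun x => ((u : BaseSpace Φ) x).im)
      (fun x => (A u x).im) where
  memLp_left := (Lp.memLp (u : BaseSpace Φ)).im
  memLp_right := (Lp.memLp (A u)).im
  weak φ hφ := by
    obtain ⟨f, g, hf, hg, hfg⟩ := hA.inner_test h hp hω u hφ
    have := congrArg Complex.im hfg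
    rw [im_inner_of_ae_eq_ofReal hf, im_inner_of_ae_eq_ofReal hg, neg_inj] at this
    simp only [h.sqrt_sq]
    refine this.trans ?_
    rw [← integral_neg]
    refine integral_congr_ae (ae_of_all _ fun x => ?_)
    simp only [div_eq_mul_inv]
    ring

theorem re_inner_nonneg (hA : IsSelfAdjointExtension p ω Φ A)
    (h : IsBellShapedMinimizer p ω Φ) (hp : 2 < p) (hω : 0 < ω) (u : A.domain) :
    0 ≤ (inner ℂ (A u) (u : BaseSpace Φ)).re := by
  have hv := h.isQuadraticProfile hp hω
  have wr := hA.isWeakPair_re h hp hω u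
  have wi := hA.isWeakPair_im h hp hω u
  have hi := L2.integrable_inner (𝕜 := ℂ) (A u) (u : BaseSpace Φ)
  have e : (inner ℂ (A u) (u : BaseSpace Φ)).re
      = (∫ x in Ioo (-halfLength Φ) (halfLength Φ), (A u x).re * ((u : BaseSpace Φ) x).re)
        + ∫ x in Ioo (-halfLength Φ) (halfLength Φ), (A u x).im * ((u : BaseSpace Φ) x).im := by
    have ir : IntegrableOn (fun x => (A u x).re * ((u : BaseSpace Φ) x).re)
        (Ioo (-halfLength Φ) (halfLength Φ)) := wr.memLp_right.integrable_mul wr.memLp_left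
    have ii : IntegrableOn (fun x => (A u x).im * ((u : BaseSpace Φ) x).im)
        (Ioo (-halfLength Φ) (halfLength Φ)) := wi.memLp_right.integrable_mul wi.memLp_left
    rw [← integral_add ir ii, L2.inner_def]
    refine (Complex.reCLM.integral_comp_comm hi).symm.trans
      (integral_congr_ae (ae_of_all _ fun x => ?_))
    simp
    ring
  rw [e]
  exact add_nonneg (hv.integral_mul_nonneg wr) (hv.integral_mul_nonneg wi)

theorem operatorKernel_eq (hA : IsSelfAdjointExtension p ω Φ A)
    (h : IsBellShapedMinimizer p ω Φ) (hp : 2 < p) (hω : 0 < ω) {e : BaseSpace Φ}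
    (he : e =ᵐ[volume.restrict (bodyInterval Φ)] (fun x => (Φ x : ℂ))) :
    operatorKernel A = Submodule.span ℂ {e} := by
  have hv := h.isQuadraticProfile hp hω
  apply le_antisymm
  · rintro _ ⟨u, hu, rfl⟩
    have hu0 : A u = 0 := hu
    have z : ∀ᵐ x ∂(volume.restrict (bodyInterval Φ)), A u x = 0 := by
      rw [hu0]
      exact Lp.coeFn_zero _ _ _
    obtain ⟨k, hk⟩ := hv.eq_const_mul_sqrt (hA.isWeakPair_re h hp hω u) (by
      filter_upwards [z] with x hx
      simp [hx])
    obtain ⟨l, hl⟩ := hv.eq_const_mul_sqrt (hA.isWeakPair_im h hp hω u) (by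
      filter_upwards [z] with x hx
      simp [hx])
    refine Submodule.mem_span_singleton.2 ⟨⟨k, l⟩, ?_⟩
    refine Lp.ext ?_
    filter_upwards [Lp.coeFn_smul (⟨k, l⟩ : ℂ) e, he, hk, hl] with x h1 h2 h3 h4
    simp only [h.sqrt_sq] at h3 h4
    rw [h1, Pi.smul_apply, h2]
    refine Complex.ext ?_ ?_
    · simp [h3]
    · simp [h4]
  · rw [Submodule.span_singleton_le_iff_mem]
    -- It is not clear directly that `Φ` lies in the domain of `A`. Orthogonality to the range puts
    -- it in the adjoint's domain with image zero, and self-adjointness transfers this to `A`.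
    have horth : ∀ u : A.domain, inner ℂ (0 : BaseSpace Φ) (u : BaseSpace Φ)
        = inner ℂ e (A u) := by
      intro u
      rw [inner_zero_left, ← inner_conj_symm, eq_comm, map_eq_zero]
      have r := hv.integral_mul_sqrt_eq_zero (hA.isWeakPair_re h hp hω u)
      have i := hv.integral_mul_sqrt_eq_zero (hA.isWeakPair_im h hp hω u)
      simp only [h.sqrt_sq] at r i
      refine Complex.ext ?_ ?_
      · rw [re_inner_of_ae_eq_ofReal he]
        exact r
      · rw [im_inner_of_ae_eq_ofReal he, Complex.zero_im, neg_eq_zero]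
        exact i
    have hmem : e ∈ A.adjoint.domain := LinearPMap.mem_adjoint_domain_of_exists e ⟨0, horth⟩
    have hval := LinearPMap.adjoint_apply_eq hA.selfAdjoint.dense_domain ⟨e, hmem⟩ horth
    have hgraph : ((e, 0) : BaseSpace Φ × BaseSpace Φ) ∈ A.adjoint.graph :=
      (LinearPMap.mem_graph_iff _).2 ⟨⟨e, hmem⟩, rfl, hval⟩
    rw [LinearPMap.isSelfAdjoint_def.1 hA.selfAdjoint] at hgraph
    obtain ⟨y, hy1, hy2⟩ := (LinearPMap.mem_graph_iff A).1 hgraph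
    exact ⟨y, hy2, hy1⟩

end IsSelfAdjointExtension

end

theorem proposition6 (p ω : ℝ) (hp : 2 < p) (hω : 0 < ω) (Φ : ℝ → ℝ)
    (hΦ : IsBellShapedMinimizer p ω Φ)
    (A : BaseSpace Φ →ₗ.[ℂ] BaseSpace Φ) (hA : IsSelfAdjointExtension p ω Φ A) :
    (∀ u : A.domain, 0 ≤ (inner ℂ (A u) (u : BaseSpace Φ)).re) ∧
    Module.finrank ℂ (operatorKernel A) = 1 ∧
    ∃ e : BaseSpace Φ,
      e =ᵐ[volume.restrict (bodyInterval Φ)] (fun x => (Φ x : ℂ)) ∧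
      operatorKernel A = Submodule.span ℂ {e} := by
  have hm : MemLp (fun x => (Φ x : ℂ)) 2 (volume.restrict (bodyInterval Φ)) :=
    hΦ.admissible.memLp.ofReal.restrict _
  have hker := hA.operatorKernel_eq hΦ hp hω hm.coeFn_toLp
  refine ⟨hA.re_inner_nonneg hΦ hp hω, ?_, hm.toLp, hm.coeFn_toLp, hker⟩
  rw [hker]
  -- The spanning vector is nonzero because `Φ` is positive on an interval of positive length.
  refine finrank_span_singleton fun h0 => ?_
  have hL := hΦ.halfLength_pos hp hω
  have hz : ∀ᵐ x ∂(volume.restrict (bodyInterval Φ)), False := by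
    filter_upwards [hm.coeFn_toLp, Lp.coeFn_zero ℂ 2 (volume.restrict (bodyInterval Φ)),
      ae_restrict_mem measurableSet_Ioo] with x h1 h2 h3
    rw [h0, h2] at h1
    exact (hΦ.pos hp hω h3).ne' (Complex.ofReal_eq_zero.1 h1.symm)
  rw [ae_iff] at hz
  simp only [not_false_eq_true, Set.ofPred_true, Measure.restrict_apply_univ, bodyInterval,
    Real.volume_Ioo, ENNReal.ofReal_eq_zero] at hz
  linarith
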